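/- **Theorem (bias of quadratic functions under HOGWILD!-Gibbs).** Let $p$ be an Ising model without external field on a graph $G=(V,E)$ with $V=\{1,\dots,n\}$, i.e. $p(x)\propto\exp\big(\sum_{\{u,v\}\in E}\theta_{uv}x_ux_v\big)$ on $\{\pm1\}^n$. Let $I(j,i)$ be the maximum, over pairs $x,y$ that differ only at node $j$, of $\|p_i(\cdot\mid x^{-i})-p_i(\cdot\mid y^{-i})\|_{TV}$, where $p_i(\cdot\mid x^{-i})$ is the conditional law of node $i$ given the other nodes, and let $\alpha=\max_i\sum_j I(j,i)$ be the Dobrushin parameter of $p$. Consider a sequential Gibbs sampler $(X_t)$ and a HOGWILD! Gibbs sampler $(Y_t)$ with $X_0=Y_0$ under the greedy coupling: at step $t+1$ both chains update the same uniformly random node $i$, using the same $u$ uniform on $[0,1]$; a chain sets the spin to $+1$ if $u$ is at most its current conditional probability of $+1$ at $i$, and to $-1$ otherwise. The sequential chain uses the conditional law at $X_t$. The HOGWILD! chain uses the conditional law at the stale state whose $j$-th coordinate is $Y_{j,\,t-\tau_{j,t+1}}$ (with $Y_{j,s}=Y_{j,0}$ for $s<0$), where the delays $\tau_{j,t+1}$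 are random nonnegative integers. Let $\mathcal F_t$ contain all events up to time $t$. The pair $(i,u)$ of step $t+1$ is independent of $\mathcal F_t$ and the delays of step $t+1$, and $\mathbf E[\tau_{j,t+1}\mid\mathcal F_t]\le\tau$ for all $j,t$; the delays of different reads may be correlated. Then for all $\bar\tau\in\mathbb R$ and $\bar\alpha<1$ there is a constant $c_2=c_2(\bar\tau,\bar\alpha)>0$ such that for every $n$, every such $p$ with $\alpha\le\bar\alpha$, every such coupled pair with $\tau\le\bar\tau$, every $f_a(x)=\sum_{i<j}a_{ij}x_ix_j$ with $\|a\|_\infty=\max_{i<j}|a_{ij}|$, and every integer $t>\frac{6n}{1-\alpha}\log\big(2\max\{\|a\|_\infty,1\}\,n\big)$, $$\big|\mathbf E[f_a(X_t)-f_a(Y_t)]\big|\le c_2\,\|a\|_\infty\,\frac{\tau\alpha\log n}{(1-\alpha)^{3/2}}\,(n\log n)^{1/2}.$$ -/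

import Mathlib

open MeasureTheory ProbabilityTheory

/-- Spin configurations on `n` nodes; `ℤˣ = {1, -1}`. -/
abbrev SpinConfig (n : ℕ) : Type := Fin n → ℤˣ

/-- The spin of node `v`, as a real number. -/
def spin {n : ℕ} (x : SpinConfig n) (v : Fin n) : ℝ := ((x v : ℤ) : ℝ)

/-- An Ising model: a graph on `n` nodes with one real parameter per node and per edge
(only the values of `edgeParam` on edges of `graph` are used). -/
structure IsingModel (n : ℕ) where
  graph : SimpleGraph (Fin n)
  nodeParam : Fin n → ℝ
  edgeParam : Sym2 (Fin n) → ℝ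

namespace IsingModel

variable {n : ℕ}

open scoped Classical in
/-- `∑_v θ_v x_v + ∑_{e = {u,v} ∈ E} θ_e x_u x_v`. -/
noncomputable def energy (p : IsingModel n) (x : SpinConfig n) : ℝ :=
  ∑ v, p.nodeParam v * spin x v + ∑ e ∈ p.graph.edgeFinset, p.edgeParam e * (e.map (spin x)).mul

/-- The log-partition function `Φ(θ)`. -/
noncomputable def logPartition (p : IsingModel n) : ℝ :=
  Real.log (∑ x : SpinConfig n, Real.exp (p.energy x))

/-- The probability mass function of the Ising model. -/
noncomputable def prob (p : IsingModel n) (x : SpinConfig n) : ℝ :=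
  Real.exp (p.energy x - p.logPartition)

def NoExternalField (p : IsingModel n) : Prop := ∀ v, p.nodeParam v = 0

end IsingModel

section Gibbs

variable {n : ℕ}

/-- `π_i(s | x^{-i})`: the conditional probability under `π` that node `i` has spin `s`, given
the spins of all other nodes in `x`. -/
noncomputable def condProb (π : SpinConfig n → ℝ) (i : Fin n) (x : SpinConfig n) (s : ℤˣ) : ℝ :=
  π (Function.update x i s) / ∑ r : ℤˣ, π (Function.update x i r)

/-- Total variation distance of two mass functions on the spins. -/
noncomputable def spinTV (q r : ℤˣ → ℝ) : ℝ := (∑ s : ℤˣ, |q s - r s|) / 2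

/-- `influence π j i` is the influence `I(j, i)` of node `j` on node `i`: the maximum, over pairs
of states that agree off `j`, of the distance of the conditional laws at `i`. -/
noncomputable def influence (π : SpinConfig n → ℝ) (j i : Fin n) : ℝ :=
  ⨆ z : {z : SpinConfig n × SpinConfig n // ∀ k, k ≠ j → z.1 k = z.2 k},
    spinTV (condProb π i z.1.1) (condProb π i z.1.2)

/-- The Dobrushin parameter `α = max_i ∑_j I(j, i)`. -/
noncomputable def dobrushin (π : SpinConfig n → ℝ) : ℝ :=
  ⨆ i : Fin n, ∑ j : Fin n, influence π j i

/-- The greedy rule for one chain, with the spin values listed in the order `+1, -1`: if the chain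
sets the spin to `+1` with probability `q`, then it becomes `+1` when the number `u` drawn
from `[0, 1]` lies in `[0, q]`, and `-1` otherwise. -/
noncomputable def greedyDraw (q u : ℝ) : ℤˣ := if u ≤ q then 1 else -1

/-- Sequential Gibbs sampling from `x₀`; at step `t` node `node t` is updated with the number
`u t`. -/
noncomputable def sequentialRun (π : SpinConfig n → ℝ) (x₀ : SpinConfig n)
    (node : ℕ → Fin n) (u : ℕ → ℝ) : ℕ → SpinConfig n
  | 0 => x₀
  | t + 1 =>
    let x := sequentialRun π x₀ node u t
    Function.update x (node (t + 1))
      (greedyDraw (condProb π (node (t + 1)) x 1) (u (t + 1)))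

/-- HOGWILD! Gibbs sampling from `x₀`; the update at step `t + 1` reads node `j` with delay
`delay (t + 1) j`, that is, it reads the value that `j` had at time `t - delay (t + 1) j`
(the initial value, if the delay exceeds `t`). -/
noncomputable def hogwildRun (π : SpinConfig n → ℝ) (x₀ : SpinConfig n)
    (node : ℕ → Fin n) (u : ℕ → ℝ) (delay : ℕ → Fin n → ℕ) : ℕ → SpinConfig n
  | 0 => x₀
  | t + 1 =>
    Function.update (hogwildRun π x₀ node u delay t) (node (t + 1))
      (greedyDraw
        (condProb π (node (t + 1))
          (fun j => hogwildRun π x₀ node u delay (t - delay (t + 1) j) j) 1)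
        (u (t + 1)))
  termination_by t => t
  decreasing_by all_goals omega

/-- The randomness of a sequential and a HOGWILD! run that start in the same state and are coupled
greedily (same node, same uniform number at every step), with average contention parameter `τ`.
`ℱ t` holds all events up to time `t`. The delays of one step may be correlated with each other
and with the past; given the past, each has mean at most `τ`. -/
structure GreedyCoupling (n : ℕ) (τ : ℝ) {Ω : Type*} [mΩ : MeasurableSpace Ω]
    (μ : Measure Ω) where
  ℱ : Filtration ℕ mΩ
  init : Ω → SpinConfig n
  node : ℕ → Ω → Fin n
  unif : ℕ → Ω → ℝ
  delay : ℕ → Fin n → Ω → ℕ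
  init_meas : Measurable[ℱ 0] init
  node_meas : ∀ t, Measurable[ℱ (t + 1)] (node (t + 1))
  unif_meas : ∀ t, Measurable[ℱ (t + 1)] (unif (t + 1))
  delay_meas : ∀ t i, Measurable[ℱ (t + 1)] (delay (t + 1) i)
  /-- The updated node is uniform, and the number that is drawn is independent of it and uniform
  on `[0, 1]`. -/
  update_law : ∀ t, μ.map (fun ω => (node (t + 1) ω, unif (t + 1) ω)) =
    (uniformOn (Set.univ : Set (Fin n))).prod (volume.restrict (Set.Icc (0 : ℝ) 1))
  /-- Both are independent of the past and of the delays of the current reads. -/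
  update_indep : ∀ t, Indep
    (MeasurableSpace.comap (fun ω => (node (t + 1) ω, unif (t + 1) ω)) inferInstance)
    (ℱ t ⊔ ⨆ i, MeasurableSpace.comap (delay (t + 1) i) inferInstance) μ
  delay_integrable : ∀ t i, Integrable (fun ω => (delay (t + 1) i ω : ℝ)) μ
  delay_mean : ∀ t i, μ[fun ω => (delay (t + 1) i ω : ℝ) | ℱ t] ≤ᵐ[μ] fun _ => τ

namespace GreedyCoupling

variable {τ : ℝ} {Ω : Type*} [MeasurableSpace Ω] {μ : Measure Ω}

/-- The state `X_t` of the sequential chain. -/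
noncomputable def seq (K : GreedyCoupling n τ μ) (π : SpinConfig n → ℝ) (t : ℕ) (ω : Ω) :
    SpinConfig n :=
  sequentialRun π (K.init ω) (fun s => K.node s ω) (fun s => K.unif s ω) t

/-- The state `Y_t` of the HOGWILD! chain. -/
noncomputable def hog (K : GreedyCoupling n τ μ) (π : SpinConfig n → ℝ) (t : ℕ) (ω : Ω) :
    SpinConfig n :=
  hogwildRun π (K.init ω) (fun s => K.node s ω) (fun s => K.unif s ω)
    (fun s i => K.delay s i ω) t

end GreedyCoupling

/-- `f_a(x) = ∑_{i<j} a_ij x_i x_j`. The norm `‖a‖` of the coefficient vector is the sup norm. -/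
noncomputable def quadForm (a : {e : Fin n × Fin n // e.1 < e.2} → ℝ) (x : SpinConfig n) : ℝ :=
  ∑ e, a e * spin x e.1.1 * spin x e.1.2

end Gibbs

/-! Write `P` for the Gibbs operator `glauber`, `D_j` for the discrete derivative `spinDiff j`,
`q_j` for the conditional probability of `+1` at `j`, `π` for the Ising law, and `ρ = 1 - (1 - α) /
n`.

Since `E f(X_t) = E (P^t f)(X_0)`, the bias telescopes into one-step errors: at time `s` a HOGWILD!
step is compared with one step of `P`, both applied to `g = P^(t-1-s) f`
(`abs_integral_hog_sub_iterate_le`). The two differ only in where `q_j` is evaluated, so the error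
is at most `(1/n) ∑_j E |q_j(stale) - q_j(Y_s)| |D_j g(Y_s)|`, and the difference of the `q_j` is at
most the sum of the influences of the outdated nodes. The indicator that `k` is outdated is at most
its delay times a weight `kappa` known at time `s`, whose mean is `O(log n / n)`. Conditioning on
the past then replaces the delay by `τ`, with no independence of delays and past.

It remains to bound `∑_j E[kappa_k |D_j g(Y_s)|]`. Bounding `D_j g` by its supremum gives order
`n^2`, hence a bias of order `n log n`. The missing factor `√n` is gained at stationarity. As `f` is
even, `D_j f` is odd, so a Poincaré inequality and the bounded second differences of `f` give `E_π
|D_j f| = O(√n)`. The Dirichlet form decays like `ρ^(2r)` along `P^r`, so `∑_j E_π |D_j P^r f| =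
O(ρ^r n^(3/2))` (`sum_wmean_abs_spinDiff_le`). Both facts follow from the contraction of the total
oscillation, by reversibility and log-convexity.

To pass from `π` to `Y_s`, the same telescoping with the crude supremum bound gives `E h(Y_s) ≤ π h
+ (ρ^s + τ α O(log n) / (n (1 - α))) totalOsc h` (`integral_hog_le`). For `h = |D_j g|` the
oscillations sum over `j` to at most the second-order oscillation of `g`, which is `O(ρ^r n^2)` for
`g = P^r f`, because the second derivatives of `q_m` in a pairwise model are bounded by products of
influences (`totalOsc₂_iterate_le`). The factor `kappa` is handled by restricting to the event that
a node was updated at a given recent time: that update is nearly a heat-bath step, which preserves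
`π` (`integral_kappa_mul_hog_le`). Summing over `s` proves the bound. -/

open Function (update)

/-! ### Discrete derivatives and oscillations of functions of spins. -/

section SpinCalculus

variable {n : ℕ}

/-- The discrete derivative of `h` in the direction of node `i`. -/
def spinDiff (i : Fin n) (h : SpinConfig n → ℝ) (x : SpinConfig n) : ℝ :=
  h (update x i 1) - h (update x i (-1))

/-- The oscillation of `h` at node `i`. -/
noncomputable def spinOsc (i : Fin n) (h : SpinConfig n → ℝ) : ℝ := ⨆ x, |spinDiff i h x|

/-- The total oscillation. -/
noncomputable def totalOsc (h : SpinConfig n → ℝ) : ℝ := ∑ i, spinOsc i h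

/-- The total second-order oscillation. -/
noncomputable def totalOsc₂ (h : SpinConfig n → ℝ) : ℝ :=
  ∑ i, totalOsc (spinDiff i h)

/-- The heat-bath update of node `i`, where `q i x` is the probability of the spin `+1`. -/
def heatBath (q : Fin n → SpinConfig n → ℝ) (i : Fin n) (h : SpinConfig n → ℝ)
    (x : SpinConfig n) : ℝ :=
  q i x * h (update x i 1) + (1 - q i x) * h (update x i (-1))

/-- The transition operator of the Gibbs sampler. -/
noncomputable def glauber (q : Fin n → SpinConfig n → ℝ) (h : SpinConfig n → ℝ)
    (x : SpinConfig n) : ℝ :=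
  (∑ i, heatBath q i h x) / n

/-- Single-site update probabilities `q` with influences bounded by a matrix `I` whose sums over
the influencing node are at most `α`. -/
structure IsDobrushin (q : Fin n → SpinConfig n → ℝ) (I : Fin n → Fin n → ℝ) (α : ℝ) : Prop where
  update_self : ∀ i x s, q i (update x i s) = q i x
  nonneg : ∀ i x, 0 ≤ q i x
  le_one : ∀ i x, q i x ≤ 1
  abs_spinDiff_le : ∀ j i x, |spinDiff j (q i) x| ≤ I j i
  infl_nonneg : ∀ j i, 0 ≤ I j i
  sum_infl_le : ∀ i, ∑ j, I j i ≤ α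

lemma abs_spinDiff_le_spinOsc (i : Fin n) (h : SpinConfig n → ℝ) (x : SpinConfig n) :
    |spinDiff i h x| ≤ spinOsc i h :=
  le_ciSup (f := fun x => |spinDiff i h x|) (Set.finite_range _).bddAbove x

lemma spinOsc_le {i : Fin n} {h : SpinConfig n → ℝ} {c : ℝ} (hc : ∀ x, |spinDiff i h x| ≤ c) :
    spinOsc i h ≤ c :=
  ciSup_le hc

lemma spinOsc_nonneg (i : Fin n) (h : SpinConfig n → ℝ) : 0 ≤ spinOsc i h :=
  (abs_nonneg _).trans (abs_spinDiff_le_spinOsc i h 1)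

lemma totalOsc_nonneg (h : SpinConfig n → ℝ) : 0 ≤ totalOsc h :=
  Finset.sum_nonneg fun i _ => spinOsc_nonneg i h

lemma totalOsc₂_nonneg (h : SpinConfig n → ℝ) : 0 ≤ totalOsc₂ h :=
  Finset.sum_nonneg fun _ _ => totalOsc_nonneg _

lemma spinDiff_spinDiff_self (i : Fin n) (h : SpinConfig n → ℝ) (x : SpinConfig n) :
    spinDiff i (spinDiff i h) x = 0 := by
  simp [spinDiff]

lemma spinDiff_comm (i k : Fin n) (h : SpinConfig n → ℝ) (x : SpinConfig n) :
    spinDiff i (spinDiff k h) x = spinDiff k (spinDiff i h) x := by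
  rcases eq_or_ne i k with rfl | hik
  · rfl
  · simp only [spinDiff, Function.update_comm hik]; ring

lemma spinOsc_spinDiff_comm (i k : Fin n) (h : SpinConfig n → ℝ) :
    spinOsc i (spinDiff k h) = spinOsc k (spinDiff i h) := by
  simp only [spinOsc, spinDiff_comm i k h]

lemma spinOsc_spinDiff_self (i : Fin n) (h : SpinConfig n → ℝ) :
    spinOsc i (spinDiff i h) = 0 := by
  simp [spinOsc, spinDiff_spinDiff_self]

lemma spinOsc_abs_le (i : Fin n) (h : SpinConfig n → ℝ) :
    spinOsc i (fun x => |h x|) ≤ spinOsc i h :=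
  spinOsc_le fun x => (abs_abs_sub_abs_le_abs_sub _ _).trans (abs_spinDiff_le_spinOsc i h x)

lemma totalOsc_abs_le (h : SpinConfig n → ℝ) : totalOsc (fun x => |h x|) ≤ totalOsc h :=
  Finset.sum_le_sum fun i _ => spinOsc_abs_le i h

lemma abs_sub_update_le (h : SpinConfig n → ℝ) (x : SpinConfig n) (i : Fin n) (s t : ℤˣ) :
    |h (update x i s) - h (update x i t)| ≤ |spinDiff i h x| := by
  rcases Int.units_eq_one_or s with rfl | rfl <;> rcases Int.units_eq_one_or t with rfl | rfl <;>
    simp [spinDiff, abs_sub_comm]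

/-- Changing the coordinates in `A` one at a time. -/
lemma abs_sub_piecewise_le (h : SpinConfig n → ℝ) {c : Fin n → ℝ}
    (hc : ∀ i x, |spinDiff i h x| ≤ c i) (x y : SpinConfig n) (A : Finset (Fin n)) :
    |h (A.piecewise y x) - h x| ≤ ∑ i ∈ A, if y i = x i then 0 else c i := by
  classical
  induction A using Finset.induction_on with
  | empty => simp
  | insert a A ha ih =>
    rw [Finset.sum_insert ha, Finset.piecewise_insert]
    refine (abs_sub_le _ (h (A.piecewise y x)) _).trans (add_le_add ?_ ih)
    have hx : A.piecewise y x = update (A.piecewise y x) a (x a) := by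
      rw [Function.eq_update_iff]; simp [ha]
    split_ifs with hya
    · rw [hya, ← hx]; simp
    · nth_rw 2 [hx]
      exact (abs_sub_update_le _ _ _ _ _).trans (hc _ _)

lemma abs_sub_le_sum (h : SpinConfig n → ℝ) {c : Fin n → ℝ}
    (hc : ∀ i x, |spinDiff i h x| ≤ c i) (x y : SpinConfig n) :
    |h y - h x| ≤ ∑ i, if y i = x i then 0 else c i := by
  simpa using abs_sub_piecewise_le h hc x y Finset.univ

lemma abs_sub_le_totalOsc (h : SpinConfig n → ℝ) (x y : SpinConfig n) :
    |h y - h x| ≤ totalOsc h := by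
  refine (abs_sub_le_sum h (abs_spinDiff_le_spinOsc · h ·) x y).trans ?_
  refine Finset.sum_le_sum fun i _ => ?_
  split_ifs
  exacts [spinOsc_nonneg i h, le_rfl]

/-- An odd function is bounded by half of its total oscillation. -/
lemma abs_le_totalOsc_of_odd {h : SpinConfig n → ℝ} (hodd : ∀ x, h (-x) = -h x)
    (x : SpinConfig n) : |h x| ≤ totalOsc h / 2 := by
  have := abs_sub_le_totalOsc h (-x) x
  rw [hodd, sub_neg_eq_add, ← two_mul, abs_mul, abs_two] at this
  linarith

lemma update_neg (x : SpinConfig n) (i : Fin n) (s : ℤˣ) :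
    update (-x) i s = -update x i (-s) := by
  ext j
  rcases eq_or_ne j i with rfl | hj <;> simp [*]

lemma spinDiff_odd {h : SpinConfig n → ℝ} (heven : ∀ x, h (-x) = h x) (i : Fin n)
    (x : SpinConfig n) : spinDiff i h (-x) = -spinDiff i h x := by
  simp [spinDiff, update_neg, heven]

end SpinCalculus

/-! ### Contraction of first- and second-order oscillations under Dobrushin's condition. -/

section HeatBath

variable {n : ℕ} {q : Fin n → SpinConfig n → ℝ} {I : Fin n → Fin n → ℝ} {α : ℝ}

lemma heatBath_update_self (hq : ∀ i x s, q i (update x i s) = q i x) (i : Fin n)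
    (h : SpinConfig n → ℝ) (x : SpinConfig n) (s : ℤˣ) :
    heatBath q i h (update x i s) = heatBath q i h x := by
  simp [heatBath, hq]

lemma spinDiff_heatBath_self (hq : ∀ i x s, q i (update x i s) = q i x) (i : Fin n)
    (h : SpinConfig n → ℝ) (x : SpinConfig n) : spinDiff i (heatBath q i h) x = 0 := by
  simp [spinDiff, heatBath_update_self hq]

/-- A product rule: the derivative falls either on `h`, leaving a convex combination, or on the
probability `q i`. -/
lemma spinDiff_heatBath {i k : Fin n} (hik : i ≠ k) (h : SpinConfig n → ℝ) (x : SpinConfig n) :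
    spinDiff k (heatBath q i h) x =
      q i (update x k (-1)) * spinDiff k h (update x i 1)
        + (1 - q i (update x k (-1))) * spinDiff k h (update x i (-1))
        + spinDiff k (q i) x * spinDiff i h (update x k 1) := by
  simp only [spinDiff, heatBath, Function.update_comm hik]; ring

lemma abs_convex_comb_le {p a b c : ℝ} (h0 : 0 ≤ p) (h1 : p ≤ 1) (ha : |a| ≤ c) (hb : |b| ≤ c) :
    |p * a + (1 - p) * b| ≤ c := by
  rw [abs_le] at *
  constructor <;> nlinarith

lemma IsDobrushin.spinOsc_heatBath_le (hD : IsDobrushin q I α) {i k : Fin n} (hik : i ≠ k)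
    (h : SpinConfig n → ℝ) :
    spinOsc k (heatBath q i h) ≤ spinOsc k h + I k i * spinOsc i h := by
  refine spinOsc_le fun x => ?_
  rw [spinDiff_heatBath hik]
  refine (abs_add_le _ _).trans (add_le_add ?_ ?_)
  · exact abs_convex_comb_le (hD.nonneg _ _) (hD.le_one _ _) (abs_spinDiff_le_spinOsc _ _ _)
      (abs_spinDiff_le_spinOsc _ _ _)
  · rw [abs_mul]
    exact mul_le_mul (hD.abs_spinDiff_le _ _ _) (abs_spinDiff_le_spinOsc _ _ _) (abs_nonneg _)
      (hD.infl_nonneg _ _)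

lemma IsDobrushin.spinOsc_heatBath_self (hD : IsDobrushin q I α) (i : Fin n)
    (h : SpinConfig n → ℝ) : spinOsc i (heatBath q i h) = 0 := by
  simp [spinOsc, spinDiff_heatBath_self hD.update_self]

/-- Updating `i` erases the oscillation at `i` and hands at most the fraction `∑ k, I k i ≤ α` of it
to the other nodes. -/
lemma IsDobrushin.totalOsc_heatBath_le (hD : IsDobrushin q I α) (i : Fin n)
    (h : SpinConfig n → ℝ) :
    totalOsc (heatBath q i h) ≤ totalOsc h - (1 - α) * spinOsc i h := by
  have key : ∀ k, spinOsc k (heatBath q i h) ≤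
      (spinOsc k h + I k i * spinOsc i h) - if k = i then spinOsc i h else 0 := by
    intro k
    split_ifs with hk
    · subst hk
      rw [hD.spinOsc_heatBath_self]
      have := mul_nonneg (hD.infl_nonneg k k) (spinOsc_nonneg k h)
      linarith
    · simpa using hD.spinOsc_heatBath_le (Ne.symm hk) h
  calc totalOsc (heatBath q i h)
      ≤ ∑ k, ((spinOsc k h + I k i * spinOsc i h) - if k = i then spinOsc i h else 0) :=
        Finset.sum_le_sum fun k _ => key k
    _ = totalOsc h + (∑ k, I k i) * spinOsc i h - spinOsc i h := by
        rw [Finset.sum_sub_distrib, Finset.sum_add_distrib, Finset.sum_mul]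
        simp [totalOsc]
    _ ≤ _ := by nlinarith [mul_le_mul_of_nonneg_right (hD.sum_infl_le i) (spinOsc_nonneg i h)]

lemma spinDiff_glauber (k : Fin n) (h : SpinConfig n → ℝ) (x : SpinConfig n) :
    spinDiff k (glauber q h) x = (∑ i, spinDiff k (heatBath q i h) x) / n := by
  simp only [spinDiff, glauber, Finset.sum_sub_distrib]; ring

lemma spinDiff_spinDiff_glauber (i k : Fin n) (h : SpinConfig n → ℝ) (x : SpinConfig n) :
    spinDiff i (spinDiff k (glauber q h)) x =
      (∑ m, spinDiff i (spinDiff k (heatBath q m h)) x) / n := by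
  simp only [spinDiff, glauber, Finset.sum_sub_distrib]; ring

lemma spinOsc_glauber_le (k : Fin n) (h : SpinConfig n → ℝ) :
    spinOsc k (glauber q h) ≤ (∑ i, spinOsc k (heatBath q i h)) / n := by
  refine spinOsc_le fun x => ?_
  rw [spinDiff_glauber, abs_div, Nat.abs_cast]
  gcongr
  exact (Finset.abs_sum_le_sum_abs _ _).trans
    (Finset.sum_le_sum fun i _ => abs_spinDiff_le_spinOsc _ _ _)

/-- The factor by which one step of the Gibbs sampler contracts the total oscillation. -/
noncomputable def contractionRate (n : ℕ) (α : ℝ) : ℝ := 1 - (1 - α) / n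

lemma IsDobrushin.totalOsc_glauber_le (hD : IsDobrushin q I α) (hn : n ≠ 0)
    (h : SpinConfig n → ℝ) :
    totalOsc (glauber q h) ≤ contractionRate n α * totalOsc h := by
  have hn' : (n : ℝ) ≠ 0 := by exact_mod_cast hn
  calc totalOsc (glauber q h) ≤ ∑ k, (∑ i, spinOsc k (heatBath q i h)) / n :=
        Finset.sum_le_sum fun k _ => spinOsc_glauber_le k h
    _ = (∑ i, totalOsc (heatBath q i h)) / n := by
        rw [← Finset.sum_div, Finset.sum_comm]; rfl
    _ ≤ (∑ i, (totalOsc h - (1 - α) * spinOsc i h)) / n := by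
        gcongr with i; exact hD.totalOsc_heatBath_le i h
    _ = contractionRate n α * totalOsc h := by
        rw [Finset.sum_sub_distrib, ← Finset.mul_sum]
        simp only [Finset.sum_const, Finset.card_univ, Fintype.card_fin, nsmul_eq_mul,
          contractionRate]
        rw [show ∑ i, spinOsc i h = totalOsc h from rfl]
        field_simp

lemma IsDobrushin.totalOsc_heatBath_le' (hD : IsDobrushin q I α) (hα : α ≤ 1) (i : Fin n)
    (h : SpinConfig n → ℝ) : totalOsc (heatBath q i h) ≤ totalOsc h := by
  have := hD.totalOsc_heatBath_le i h
  nlinarith [spinOsc_nonneg i h]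

lemma IsDobrushin.alpha_nonneg (hD : IsDobrushin q I α) (hn : n ≠ 0) : 0 ≤ α :=
  (Finset.sum_nonneg fun j _ => hD.infl_nonneg j ⟨0, Nat.pos_of_ne_zero hn⟩).trans
    (hD.sum_infl_le _)

lemma contractionRate_nonneg (hn : n ≠ 0) (hα : 0 ≤ α) : 0 ≤ contractionRate n α := by
  have : (1 : ℝ) ≤ n := by exact_mod_cast Nat.one_le_iff_ne_zero.2 hn
  have : (1 - α) / n ≤ 1 := by rw [div_le_one (by linarith)]; linarith
  unfold contractionRate; linarith

lemma contractionRate_lt_one (hn : n ≠ 0) (hα : α < 1) : contractionRate n α < 1 := by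
  have : 0 < (1 - α) / n := div_pos (by linarith) (by positivity)
  unfold contractionRate; linarith

lemma IsDobrushin.totalOsc_iterate_le (hD : IsDobrushin q I α) (hn : n ≠ 0)
    (h : SpinConfig n → ℝ) (r : ℕ) :
    totalOsc ((glauber q)^[r] h) ≤ contractionRate n α ^ r * totalOsc h := by
  induction r with
  | zero => simp
  | succ r ih =>
    rw [Function.iterate_succ_apply', pow_succ', mul_assoc]
    exact (hD.totalOsc_glauber_le hn _).trans
      (mul_le_mul_of_nonneg_left ih (contractionRate_nonneg hn (hD.alpha_nonneg hn)))

lemma spinOsc_le_totalOsc (i : Fin n) (h : SpinConfig n → ℝ) : spinOsc i h ≤ totalOsc h :=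
  Finset.single_le_sum (f := fun i => spinOsc i h) (fun i _ => spinOsc_nonneg i h)
    (Finset.mem_univ i)

/-- The second-order product rule. Only the last term, with both derivatives on `q m`, involves a
first derivative of `h`. -/
lemma spinDiff_spinDiff_heatBath {i k m : Fin n} (hi : m ≠ i) (hk : m ≠ k) (hik : i ≠ k)
    (h : SpinConfig n → ℝ) (x : SpinConfig n) :
    spinDiff i (spinDiff k (heatBath q m h)) x =
      (q m (update (update x k (-1)) i (-1)) * spinDiff i (spinDiff k h) (update x m 1)
        + (1 - q m (update (update x k (-1)) i (-1))) *
          spinDiff i (spinDiff k h) (update x m (-1)))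
      + spinDiff i (q m) (update x k (-1)) * spinDiff k (spinDiff m h) (update x i 1)
      + spinDiff k (q m) (update x i (-1)) * spinDiff i (spinDiff m h) (update x k 1)
      + spinDiff i (spinDiff k (q m)) x * spinDiff m h (update (update x k 1) i 1) := by
  simp only [spinDiff, heatBath, Function.update_comm hi, Function.update_comm hk,
    Function.update_comm hik]
  ring

lemma IsDobrushin.spinOsc_spinDiff_heatBath_le (hD : IsDobrushin q I α) {i k m : Fin n}
    (hi : m ≠ i) (hk : m ≠ k) (hik : i ≠ k) (h : SpinConfig n → ℝ) :
    spinOsc k (spinDiff i (heatBath q m h)) ≤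
      spinOsc k (spinDiff i h) + I i m * spinOsc k (spinDiff m h)
        + I k m * spinOsc m (spinDiff i h) + spinOsc k (spinDiff i (q m)) * spinOsc m h := by
  rw [spinOsc_spinDiff_comm m i h, spinOsc_spinDiff_comm k i h, spinOsc_spinDiff_comm k i (q m)]
  refine spinOsc_le fun x => ?_
  rw [spinDiff_comm, spinDiff_spinDiff_heatBath hi hk hik]
  refine (abs_add_le _ _).trans (add_le_add ((abs_add_le _ _).trans
    (add_le_add ((abs_add_le _ _).trans (add_le_add ?_ ?_)) ?_)) ?_)
  · exact abs_convex_comb_le (hD.nonneg _ _) (hD.le_one _ _) (abs_spinDiff_le_spinOsc _ _ _)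
      (abs_spinDiff_le_spinOsc _ _ _)
  · rw [abs_mul]
    exact mul_le_mul (hD.abs_spinDiff_le _ _ _) (abs_spinDiff_le_spinOsc _ _ _) (abs_nonneg _)
      (hD.infl_nonneg _ _)
  · rw [abs_mul]
    exact mul_le_mul (hD.abs_spinDiff_le _ _ _) (abs_spinDiff_le_spinOsc _ _ _) (abs_nonneg _)
      (hD.infl_nonneg _ _)
  · rw [abs_mul]
    exact mul_le_mul (abs_spinDiff_le_spinOsc _ _ _) (abs_spinDiff_le_spinOsc _ _ _) (abs_nonneg _)
      (spinOsc_nonneg _ _)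

/-- One heat-bath update and the second-order oscillation, summed over all pairs. -/
lemma IsDobrushin.totalOsc₂_heatBath_le (hD : IsDobrushin q I α) {J : ℝ}
    (hJ : ∀ m, totalOsc₂ (q m) ≤ J) (m : Fin n) (h : SpinConfig n → ℝ) :
    totalOsc₂ (heatBath q m h) ≤
      totalOsc₂ h - 2 * (1 - α) * totalOsc (spinDiff m h) + J * spinOsc m h := by
  -- If `i = m` or `k = m` the left side vanishes; the two subtracted terms record this, and produce
  -- the gain `2 (1 - α)`.
  have key : ∀ i k, spinOsc k (spinDiff i (heatBath q m h)) ≤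
      spinOsc k (spinDiff i h) + I i m * spinOsc k (spinDiff m h)
        + I k m * spinOsc i (spinDiff m h) + spinOsc k (spinDiff i (q m)) * spinOsc m h
        - (if i = m then spinOsc k (spinDiff m h) else 0)
        - (if k = m then spinOsc i (spinDiff m h) else 0) := by
    intro i k
    have h1 := mul_nonneg (hD.infl_nonneg i m) (spinOsc_nonneg k (spinDiff m h))
    have h2 := mul_nonneg (hD.infl_nonneg k m) (spinOsc_nonneg i (spinDiff m h))
    have h3 := mul_nonneg (spinOsc_nonneg k (spinDiff i (q m))) (spinOsc_nonneg m h)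
    have h0 := spinOsc_nonneg k (spinDiff i h)
    rcases eq_or_ne i m with rfl | hi
    · have : spinOsc k (spinDiff i (heatBath q i h)) = 0 := by
        have : spinDiff i (heatBath q i h) = fun _ => 0 :=
          funext fun x => spinDiff_heatBath_self hD.update_self i h x
        rw [this]; simp [spinOsc, spinDiff]
      rw [this]
      rcases eq_or_ne k i with rfl | hk
      · simp [spinOsc_spinDiff_self] at *
      · simp [spinOsc_spinDiff_self, hk] at *; linarith
    · rcases eq_or_ne k m with rfl | hk
      · rw [spinOsc_spinDiff_comm, spinOsc_spinDiff_comm k i h]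
        have : spinOsc i (spinDiff k (heatBath q k h)) = 0 := by
          have : spinDiff k (heatBath q k h) = fun _ => 0 :=
            funext fun x => spinDiff_heatBath_self hD.update_self k h x
          rw [this]; simp [spinOsc, spinDiff]
        rw [this]
        simp [spinOsc_spinDiff_self, hi] at *; linarith
      · rcases eq_or_ne i k with rfl | hik
        · rw [spinOsc_spinDiff_self]
          simp [hi]; linarith
        · have := hD.spinOsc_spinDiff_heatBath_le hi.symm hk.symm hik h
          rw [spinOsc_spinDiff_comm m i] at this
          simpa [hi, hk] using this
  calc totalOsc₂ (heatBath q m h)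
      ≤ ∑ i, ∑ k, (spinOsc k (spinDiff i h) + I i m * spinOsc k (spinDiff m h)
        + I k m * spinOsc i (spinDiff m h) + spinOsc k (spinDiff i (q m)) * spinOsc m h
        - (if i = m then spinOsc k (spinDiff m h) else 0)
        - (if k = m then spinOsc i (spinDiff m h) else 0)) :=
        Finset.sum_le_sum fun i _ => Finset.sum_le_sum fun k _ => key i k
    _ = totalOsc₂ h + (∑ i, I i m) * totalOsc (spinDiff m h)
        + (∑ i, I i m) * totalOsc (spinDiff m h)
        + totalOsc₂ (q m) * spinOsc m h - totalOsc (spinDiff m h) - totalOsc (spinDiff m h) := by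
        simp only [Finset.sum_sub_distrib, Finset.sum_add_distrib]
        have e1 : ∑ i, ∑ k, I i m * spinOsc k (spinDiff m h) =
            (∑ i, I i m) * totalOsc (spinDiff m h) := by
          rw [Finset.sum_mul]; simp only [totalOsc, Finset.mul_sum]
        have e2 : ∑ i, ∑ k, I k m * spinOsc i (spinDiff m h) =
            (∑ i, I i m) * totalOsc (spinDiff m h) := by
          rw [Finset.sum_comm, e1]
        have e3 : ∑ i, ∑ k, spinOsc k (spinDiff i (q m)) * spinOsc m h =
            totalOsc₂ (q m) * spinOsc m h := by
          simp only [totalOsc₂, totalOsc, Finset.sum_mul]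
        have e4 : ∑ i, ∑ k, (if i = m then spinOsc k (spinDiff m h) else 0) =
            totalOsc (spinDiff m h) := by
          rw [Finset.sum_comm]; simp [totalOsc]
        have e5 : ∑ i, ∑ k, (if k = m then spinOsc i (spinDiff m h) else 0) =
            totalOsc (spinDiff m h) := by
          simp [totalOsc]
        rw [e1, e2, e3, e4, e5]
        rfl
    _ ≤ _ := by
        nlinarith [mul_le_mul_of_nonneg_right (hD.sum_infl_le m) (totalOsc_nonneg (spinDiff m h)),
          mul_le_mul_of_nonneg_right (hJ m) (spinOsc_nonneg m h)]

lemma totalOsc₂_glauber_le_sum (h : SpinConfig n → ℝ) :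
    totalOsc₂ (glauber q h) ≤ (∑ m, totalOsc₂ (heatBath q m h)) / n := by
  have key : ∀ i k, spinOsc k (spinDiff i (glauber q h)) ≤
      (∑ m, spinOsc k (spinDiff i (heatBath q m h))) / n := by
    intro i k
    refine spinOsc_le fun x => ?_
    rw [spinDiff_spinDiff_glauber, abs_div, Nat.abs_cast]
    gcongr
    exact (Finset.abs_sum_le_sum_abs _ _).trans
      (Finset.sum_le_sum fun i _ => abs_spinDiff_le_spinOsc _ _ _)
  calc totalOsc₂ (glauber q h)
      ≤ ∑ i, ∑ k, (∑ m, spinOsc k (spinDiff i (heatBath q m h))) / n :=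
        Finset.sum_le_sum fun i _ => Finset.sum_le_sum fun k _ => key i k
    _ = (∑ m, totalOsc₂ (heatBath q m h)) / n := by
        simp only [← Finset.sum_div, totalOsc₂, totalOsc]
        congr 1
        simp_rw [fun i => Finset.sum_comm (s := Finset.univ) (t := Finset.univ)
          (f := fun k m => spinOsc k (spinDiff i (heatBath q m h)))]
        exact Finset.sum_comm

/-- A pair of nodes is hit at either end, so second-order oscillation contracts twice as fast as
first-order oscillation, up to a source term from the curvature `J` of the `q m`. -/
lemma IsDobrushin.totalOsc₂_glauber_le (hD : IsDobrushin q I α) (hn : n ≠ 0) {J : ℝ}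
    (hJ : ∀ m, totalOsc₂ (q m) ≤ J) (h : SpinConfig n → ℝ) :
    totalOsc₂ (glauber q h) ≤
      contractionRate n α ^ 2 * totalOsc₂ h + J / n * totalOsc h := by
  have hn' : (n : ℝ) ≠ 0 := by exact_mod_cast hn
  calc totalOsc₂ (glauber q h)
      ≤ (∑ m, (totalOsc₂ h - 2 * (1 - α) * totalOsc (spinDiff m h) + J * spinOsc m h)) / n := by
        refine (totalOsc₂_glauber_le_sum h).trans ?_
        gcongr with m
        exact hD.totalOsc₂_heatBath_le hJ m h
    _ = (1 - 2 * ((1 - α) / n)) * totalOsc₂ h + J / n * totalOsc h := by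
        rw [Finset.sum_add_distrib, Finset.sum_sub_distrib, ← Finset.mul_sum, ← Finset.mul_sum]
        simp only [Finset.sum_const, Finset.card_univ, Fintype.card_fin, nsmul_eq_mul]
        rw [show ∑ i, spinOsc i h = totalOsc h from rfl,
          show ∑ i, totalOsc (spinDiff i h) = totalOsc₂ h from rfl]
        field_simp
    _ ≤ _ := by
        have : 1 - 2 * ((1 - α) / n) ≤ contractionRate n α ^ 2 := by
          unfold contractionRate; nlinarith [sq_nonneg ((1 - α) / n)]
        gcongr
        exact totalOsc₂_nonneg h

lemma half_le_contractionRate (hn : 2 ≤ n) (hα : 0 ≤ α) : 1 / 2 ≤ contractionRate n α := by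
  have : (2 : ℝ) ≤ n := by exact_mod_cast hn
  have : (1 - α) / n ≤ 1 / 2 := by
    rw [div_le_div_iff₀ (by linarith) (by norm_num)]; linarith
  unfold contractionRate; linarith

lemma IsDobrushin.totalOsc₂_iterate_le (hD : IsDobrushin q I α) (hn : 2 ≤ n) (hα : α < 1)
    {J : ℝ} (hJ0 : 0 ≤ J) (hJ : ∀ m, totalOsc₂ (q m) ≤ J) (h : SpinConfig n → ℝ) (r : ℕ) :
    totalOsc₂ ((glauber q)^[r] h) ≤
      contractionRate n α ^ r * (totalOsc₂ h + 2 * J * totalOsc h / (1 - α)) := by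
  have hn0 : n ≠ 0 := by omega
  have hn' : (n : ℝ) ≠ 0 := by exact_mod_cast hn0
  have hα0 := hD.alpha_nonneg hn0
  have hα1 : 0 < 1 - α := by linarith
  set ρ := contractionRate n α with hρ
  have hρ0 : 1 / 2 ≤ ρ := half_le_contractionRate hn hα0
  have hS := totalOsc_nonneg h
  have h2 := totalOsc₂_nonneg h
  set M := totalOsc₂ h + 2 * J * totalOsc h / (1 - α) with hM
  -- The second summand of `M` is chosen to absorb the source term: `ρ ^ 2 + ρ * (1 - ρ) = ρ` closes
  -- the induction. The factor `2` in it pays for `ρ ≥ 1 / 2`, which is where `2 ≤ n` enters.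
  have hstep : J / n * totalOsc h ≤ ρ * (1 - ρ) * M := by
    have h1 : 1 - ρ = (1 - α) / n := by rw [hρ, contractionRate]; ring
    rw [h1]
    calc J / n * totalOsc h = 1 / 2 * ((1 - α) / n) * (2 * J * totalOsc h / (1 - α)) := by
          field_simp
      _ ≤ ρ * ((1 - α) / n) * M := by
          have : 2 * J * totalOsc h / (1 - α) ≤ M := by linarith
          gcongr
  induction r with
  | zero =>
    have : 0 ≤ 2 * J * totalOsc h / (1 - α) := by positivity
    simp only [Function.iterate_zero, id, pow_zero, one_mul]; linarith
  | succ r ih =>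
    rw [Function.iterate_succ_apply']
    have hr := hD.totalOsc_iterate_le hn0 h r
    calc _ ≤ ρ ^ 2 * totalOsc₂ ((glauber q)^[r] h) + J / n * totalOsc ((glauber q)^[r] h) :=
          hD.totalOsc₂_glauber_le hn0 hJ _
      _ ≤ ρ ^ 2 * (ρ ^ r * M) + J / n * (ρ ^ r * totalOsc h) := by gcongr
      _ = ρ ^ r * (ρ ^ 2 * M + J / n * totalOsc h) := by ring
      _ ≤ ρ ^ r * (ρ ^ 2 * M + ρ * (1 - ρ) * M) := by gcongr
      _ = ρ ^ (r + 1) * M := by ring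

end HeatBath

/-! ### Log-convex sequences. -/

section LogConvex

/-- A nonnegative log-convex sequence that is `O(r ^ k)` decreases by a factor `r` at each step. -/
lemma logConvex_succ_le {d : ℕ → ℝ} {C r : ℝ} (hd : ∀ k, 0 ≤ d k)
    (hconv : ∀ k, d (k + 1) ^ 2 ≤ d k * d (k + 2)) (hr : 0 < r) (hC : ∀ k, d k ≤ C * r ^ k) :
    d 1 ≤ r * d 0 := by
  by_contra! hlt
  have h1 : 0 < d 1 := lt_of_le_of_lt (mul_nonneg hr.le (hd 0)) hlt
  have h0 : 0 < d 0 := by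
    rcases (hd 0).eq_or_lt with h | h
    · have := hconv 0
      rw [← h] at this; nlinarith
    · exact h
  set b := d 1 / d 0 with hb
  have hb0 : 0 < b := div_pos h1 h0
  have hrb : r < b := by rw [hb, lt_div_iff₀ h0]; exact hlt
  -- By log-convexity the successive ratios never decrease, so an initial ratio `b > r` would
  -- persist and outgrow `C * r ^ k`.
  have key : ∀ k, 0 < d k ∧ b * d k ≤ d (k + 1) := by
    intro k
    induction k with
    | zero => exact ⟨h0, by rw [hb]; field_simp; rfl⟩
    | succ k ih =>
      obtain ⟨hk, hle⟩ := ih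
      have hk1 : 0 < d (k + 1) := lt_of_lt_of_le (mul_pos hb0 hk) hle
      refine ⟨hk1, ?_⟩
      have := hconv k
      have h2 : b * d (k + 1) * d k ≤ d (k + 2) * d k := by nlinarith
      exact le_of_mul_le_mul_right h2 hk
  have hgrow : ∀ k, d 0 * b ^ k ≤ d k := by
    intro k
    induction k with
    | zero => simp
    | succ k ih =>
      calc d 0 * b ^ (k + 1) = b * (d 0 * b ^ k) := by ring
        _ ≤ b * d k := by gcongr
        _ ≤ _ := (key k).2
  have hbr : 1 < b / r := (one_lt_div hr).2 hrb
  obtain ⟨k, hk⟩ := pow_unbounded_of_one_lt (C / d 0) hbr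
  have h3 := (hgrow k).trans (hC k)
  rw [div_pow, div_lt_div_iff₀ h0 (pow_pos hr k)] at hk
  linarith

lemma logConvex_le {d : ℕ → ℝ} {C r : ℝ} (hd : ∀ k, 0 ≤ d k)
    (hconv : ∀ k, d (k + 1) ^ 2 ≤ d k * d (k + 2)) (hr : 0 < r) (hC : ∀ k, d k ≤ C * r ^ k)
    (k : ℕ) : d k ≤ r ^ k * d 0 := by
  induction k with
  | zero => simp
  | succ k ih =>
    have := logConvex_succ_le (d := fun m => d (k + m)) (C := C * r ^ k) (fun m => hd _)
      (fun m => hconv (k + m)) hr (fun m => by rw [mul_assoc, ← pow_add]; exact hC _)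
    calc d (k + 1) ≤ r * d k := this
      _ ≤ r * (r ^ k * d 0) := by gcongr
      _ = _ := by ring

end LogConvex

/-! ### Reversibility, the Dirichlet form, and the Poincaré inequality. -/

section Reversible

variable {n : ℕ} {q : Fin n → SpinConfig n → ℝ} {I : Fin n → Fin n → ℝ} {α : ℝ}
  {w : SpinConfig n → ℝ}

/-- The probability weights `w` have the single-site conditional probabilities `q`. -/
structure IsReversible (w : SpinConfig n → ℝ) (q : Fin n → SpinConfig n → ℝ) : Prop where
  nonneg : ∀ x, 0 ≤ w x
  sum_eq_one : ∑ x, w x = 1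
  mul_eq : ∀ i x, q i x * (w (update x i 1) + w (update x i (-1))) = w (update x i 1)

/-- The mean of `h` under the weights `w`. -/
noncomputable def wmean (w h : SpinConfig n → ℝ) : ℝ := ∑ x, w x * h x

/-- The Dirichlet form of the Gibbs sampler, times the number of nodes. -/
noncomputable def dirichlet (w : SpinConfig n → ℝ) (q : Fin n → SpinConfig n → ℝ)
    (u v : SpinConfig n → ℝ) : ℝ :=
  ∑ i, wmean w (fun x => q i x * (1 - q i x) * (spinDiff i u x * spinDiff i v x))

/-- Flipping spin `i` is a bijection. This reduces identities for `wmean` to identities on each pair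
of states that differ at `i`. -/
lemma two_mul_sum_eq (F : SpinConfig n → ℝ) (i : Fin n) :
    2 * ∑ x, F x = ∑ x, (F (update x i 1) + F (update x i (-1))) := by
  have hinv : Function.Involutive (fun x : SpinConfig n => update x i (-x i)) := fun x => by simp
  have h1 : ∑ x, F (update x i (-x i)) = ∑ x, F x :=
    Equiv.sum_comp hinv.toPerm F
  rw [two_mul]
  nth_rw 2 [← h1]
  rw [← Finset.sum_add_distrib]
  refine Finset.sum_congr rfl fun x _ => ?_
  rcases Int.units_eq_one_or (x i) with h | h
  · have : update x i 1 = x := by rw [← h]; simp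
    rw [h, this]
  · have : update x i (-1) = x := by rw [← h]; simp
    rw [h, this, neg_neg, add_comm]

lemma wmean_sub (u v : SpinConfig n → ℝ) :
    wmean w (fun x => u x - v x) = wmean w u - wmean w v := by
  simp [wmean, mul_sub, Finset.sum_sub_distrib]

lemma IsReversible.wmean_mono (hw : IsReversible w q) {u v : SpinConfig n → ℝ}
    (h : ∀ x, u x ≤ v x) : wmean w u ≤ wmean w v :=
  Finset.sum_le_sum fun x _ => mul_le_mul_of_nonneg_left (h x) (hw.nonneg x)

lemma IsReversible.wmean_const (hw : IsReversible w q) (c : ℝ) : wmean w (fun _ => c) = c := by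
  rw [wmean, ← Finset.sum_mul, hw.sum_eq_one, one_mul]

lemma IsReversible.wmean_nonneg (hw : IsReversible w q) {u : SpinConfig n → ℝ}
    (h : ∀ x, 0 ≤ u x) : 0 ≤ wmean w u :=
  Finset.sum_nonneg fun x _ => mul_nonneg (hw.nonneg x) (h x)

lemma IsReversible.wmean_heatBath (hw : IsReversible w q)
    (hq : ∀ i x s, q i (update x i s) = q i x) (i : Fin n) (h : SpinConfig n → ℝ) :
    wmean w (heatBath q i h) = wmean w h := by
  have key : 2 * wmean w (heatBath q i h) = 2 * wmean w h := by
    unfold wmean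
    rw [two_mul_sum_eq _ i, two_mul_sum_eq _ i]
    refine Finset.sum_congr rfl fun x _ => ?_
    rw [heatBath_update_self hq, heatBath_update_self hq]
    have := hw.mul_eq i x
    simp only [heatBath]
    linear_combination (h (update x i 1) - h (update x i (-1))) * this
  linarith

lemma wmean_glauber_eq (h : SpinConfig n → ℝ) :
    wmean w (glauber q h) = (∑ i, wmean w (heatBath q i h)) / n := by
  simp only [wmean, glauber]
  rw [Finset.sum_comm, Finset.sum_div]
  refine Finset.sum_congr rfl fun x _ => ?_
  rw [← Finset.mul_sum, mul_div_assoc]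

lemma IsReversible.wmean_glauber (hw : IsReversible w q)
    (hq : ∀ i x s, q i (update x i s) = q i x) (hn : n ≠ 0) (h : SpinConfig n → ℝ) :
    wmean w (glauber q h) = wmean w h := by
  have hn' : (n : ℝ) ≠ 0 := by exact_mod_cast hn
  rw [wmean_glauber_eq]
  simp [hw.wmean_heatBath hq, hn']

lemma IsReversible.wmean_iterate (hw : IsReversible w q)
    (hq : ∀ i x s, q i (update x i s) = q i x) (hn : n ≠ 0) (h : SpinConfig n → ℝ) (r : ℕ) :
    wmean w ((glauber q)^[r] h) = wmean w h := by
  induction r with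
  | zero => simp
  | succ r ih => rw [Function.iterate_succ_apply', hw.wmean_glauber hq hn, ih]

/-- Given the other spins, the right side is the conditional covariance of `u` and `v` under the law
of spin `i`, a two-point law of variance `q (1 - q)` in the indicator of `+1`. -/
lemma IsReversible.wmean_mul_sub (hw : IsReversible w q)
    (hq : ∀ i x s, q i (update x i s) = q i x) (i : Fin n) (u v : SpinConfig n → ℝ) :
    wmean w (fun x => q i x * (1 - q i x) * (spinDiff i u x * spinDiff i v x)) =
      wmean w (fun x => u x * v x) - wmean w (fun x => u x * heatBath q i v x) := by
  rw [← hw.wmean_heatBath hq i (fun x => u x * v x),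
    ← hw.wmean_heatBath hq i (fun x => u x * heatBath q i v x), ← wmean_sub]
  congr 1
  funext x
  simp only [heatBath, spinDiff, hq, Function.update_idem]
  ring

lemma IsReversible.dirichlet_eq (hw : IsReversible w q)
    (hq : ∀ i x s, q i (update x i s) = q i x) (hn : n ≠ 0) (u v : SpinConfig n → ℝ) :
    dirichlet w q u v =
      n * (wmean w (fun x => u x * v x) - wmean w (fun x => u x * glauber q v x)) := by
  have hn' : (n : ℝ) ≠ 0 := by exact_mod_cast hn
  have : wmean w (fun x => u x * glauber q v x) =
      (∑ i, wmean w (fun x => u x * heatBath q i v x)) / n := by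
    simp only [wmean, glauber]
    rw [Finset.sum_comm, Finset.sum_div]
    refine Finset.sum_congr rfl fun x _ => ?_
    rw [← Finset.mul_sum, ← Finset.mul_sum]; ring
  rw [this, dirichlet]
  simp_rw [hw.wmean_mul_sub hq]
  rw [Finset.sum_sub_distrib]
  simp only [Finset.sum_const, Finset.card_univ, Fintype.card_fin, nsmul_eq_mul]
  field_simp

lemma dirichlet_comm (u v : SpinConfig n → ℝ) : dirichlet w q u v = dirichlet w q v u := by
  simp only [dirichlet, mul_comm (spinDiff _ u _)]

lemma IsReversible.wmean_mul_glauber (hw : IsReversible w q)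
    (hq : ∀ i x s, q i (update x i s) = q i x) (hn : n ≠ 0) (u v : SpinConfig n → ℝ) :
    wmean w (fun x => u x * glauber q v x) = wmean w (fun x => glauber q u x * v x) := by
  have hn' : (n : ℝ) ≠ 0 := by exact_mod_cast hn
  have h := hw.dirichlet_eq hq hn u v
  rw [dirichlet_comm, hw.dirichlet_eq hq hn v u] at h
  have h' := mul_left_cancel₀ hn' h
  simp only [mul_comm (v _)] at h'
  linarith

lemma IsReversible.dirichlet_glauber (hw : IsReversible w q)
    (hq : ∀ i x s, q i (update x i s) = q i x) (hn : n ≠ 0) (u v : SpinConfig n → ℝ) :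
    dirichlet w q (glauber q u) v = dirichlet w q u (glauber q v) := by
  rw [hw.dirichlet_eq hq hn, dirichlet_comm u, hw.dirichlet_eq hq hn,
    ← hw.wmean_mul_glauber hq hn u v]
  simp only [mul_comm (glauber q u _), mul_comm (u _)]

lemma wmean_sq_le (hw : ∀ x, 0 ≤ w x) (u v : SpinConfig n → ℝ) :
    wmean w (fun x => u x * v x) ^ 2 ≤
      wmean w (fun x => u x * u x) * wmean w (fun x => v x * v x) :=
  Finset.sum_sq_le_sum_mul_sum_of_sq_le_mul _
    (fun x _ => mul_nonneg (hw x) (mul_self_nonneg _))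
    (fun x _ => mul_nonneg (hw x) (mul_self_nonneg _)) (fun x _ => le_of_eq (by ring))

lemma IsReversible.dirichlet_sq_le (hw : IsReversible w q) (h0 : ∀ i x, 0 ≤ q i x)
    (h1 : ∀ i x, q i x ≤ 1) (u v : SpinConfig n → ℝ) :
    dirichlet w q u v ^ 2 ≤ dirichlet w q u u * dirichlet w q v v := by
  have hnn : ∀ i x, 0 ≤ w x * (q i x * (1 - q i x)) := fun i x =>
    mul_nonneg (hw.nonneg x) (mul_nonneg (h0 i x) (by linarith [h1 i x]))
  simp only [dirichlet, wmean, ← Finset.sum_product']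
  refine Finset.sum_sq_le_sum_mul_sum_of_sq_le_mul _ (fun z _ => ?_) (fun z _ => ?_)
    (fun z _ => le_of_eq (by ring))
  · rw [← mul_assoc]; exact mul_nonneg (hnn _ _) (mul_self_nonneg _)
  · rw [← mul_assoc]; exact mul_nonneg (hnn _ _) (mul_self_nonneg _)

lemma IsReversible.dirichlet_nonneg (hw : IsReversible w q) (h0 : ∀ i x, 0 ≤ q i x)
    (h1 : ∀ i x, q i x ≤ 1) (u : SpinConfig n → ℝ) : 0 ≤ dirichlet w q u u :=
  Finset.sum_nonneg fun i _ => hw.wmean_nonneg fun x =>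
    mul_nonneg (mul_nonneg (h0 i x) (by linarith [h1 i x])) (mul_self_nonneg _)

lemma IsReversible.dirichlet_le (hw : IsReversible w q) (u : SpinConfig n → ℝ) :
    dirichlet w q u u ≤ (∑ i, spinOsc i u ^ 2) / 4 := by
  rw [Finset.sum_div]
  refine Finset.sum_le_sum fun i _ => ?_
  rw [← hw.wmean_const (spinOsc i u ^ 2 / 4)]
  refine hw.wmean_mono fun x => ?_
  have h1 : spinDiff i u x * spinDiff i u x ≤ spinOsc i u ^ 2 := by
    rw [← sq, ← sq_abs]
    exact pow_le_pow_left₀ (abs_nonneg _) (abs_spinDiff_le_spinOsc i u x) 2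
  have h2 : q i x * (1 - q i x) ≤ 1 / 4 := by nlinarith [sq_nonneg (q i x - 1 / 2)]
  have h3 := mul_self_nonneg (spinDiff i u x)
  nlinarith

lemma sum_spinOsc_sq_le (u : SpinConfig n → ℝ) : ∑ i, spinOsc i u ^ 2 ≤ totalOsc u ^ 2 :=
  Finset.sum_sq_le_sq_sum_of_nonneg fun i _ => spinOsc_nonneg i u

/-- Exponential decay of the Dirichlet form along the Gibbs sampler. -/
lemma IsReversible.dirichlet_iterate_le (hw : IsReversible w q) (hD : IsDobrushin q I α)
    (hn : 2 ≤ n) (u : SpinConfig n → ℝ) (r : ℕ) :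
    dirichlet w q ((glauber q)^[r] u) ((glauber q)^[r] u) ≤
      (contractionRate n α ^ 2) ^ r * dirichlet w q u u := by
  have hn0 : n ≠ 0 := by omega
  have hα0 := hD.alpha_nonneg hn0
  have hρ : 0 < contractionRate n α := by linarith [half_le_contractionRate hn hα0]
  -- Self-adjointness of `P` and Cauchy–Schwarz make the sequence log-convex. The contraction of
  -- `totalOsc` supplies only the rate: its large constant `C` disappears from the conclusion.
  refine logConvex_le (d := fun r => dirichlet w q ((glauber q)^[r] u) ((glauber q)^[r] u))
    (C := totalOsc u ^ 2 / 4) (fun k => hw.dirichlet_nonneg hD.nonneg hD.le_one _) (fun k => ?_)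
    (by positivity) (fun k => ?_) r
  · have := hw.dirichlet_sq_le hD.nonneg hD.le_one ((glauber q)^[k] u) ((glauber q)^[k + 2] u)
    rwa [Function.iterate_succ_apply' (glauber q) (k + 1),
      ← hw.dirichlet_glauber hD.update_self hn0, ← Function.iterate_succ_apply' (glauber q) k,
      ← Function.iterate_succ_apply' (glauber q) (k + 1)] at this
  · refine (hw.dirichlet_le _).trans ?_
    have h1 := sum_spinOsc_sq_le ((glauber q)^[k] u)
    have h2 := pow_le_pow_left₀ (totalOsc_nonneg _) (hD.totalOsc_iterate_le hn0 u k) 2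
    calc _ ≤ (contractionRate n α ^ k * totalOsc u) ^ 2 / 4 := by linarith
      _ = _ := by ring

lemma glauber_odd (hqneg : ∀ i x, q i (-x) = 1 - q i x) {h : SpinConfig n → ℝ}
    (hodd : ∀ x, h (-x) = -h x) (x : SpinConfig n) : glauber q h (-x) = -glauber q h x := by
  rw [glauber, glauber, ← neg_div, ← Finset.sum_neg_distrib]
  congr 1
  refine Finset.sum_congr rfl fun i _ => ?_
  simp only [heatBath, hqneg, update_neg, hodd, neg_neg]; ring

/-- Poincaré inequality for odd functions. -/
lemma IsReversible.wmean_sq_le_dirichlet (hw : IsReversible w q) (hD : IsDobrushin q I α)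
    (hn : 2 ≤ n) (hα : α < 1) (hqneg : ∀ i x, q i (-x) = 1 - q i x) {u : SpinConfig n → ℝ}
    (hodd : ∀ x, u (-x) = -u x) :
    wmean w (fun x => u x * u x) ≤ dirichlet w q u u / (1 - α) := by
  have hn0 : n ≠ 0 := by omega
  have hn' : (0 : ℝ) < n := by positivity
  have hα0 := hD.alpha_nonneg hn0
  set ρ := contractionRate n α with hρdef
  have hρ : 0 < ρ := by linarith [half_le_contractionRate hn hα0]
  -- Oddness survives `P`, and bounds `P ^ k u` itself, not only its differences, by the total
  -- oscillation. It plays the role of mean zero.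
  have hoddk : ∀ k x, (glauber q)^[k] u (-x) = -(glauber q)^[k] u x := by
    intro k
    induction k with
    | zero => exact hodd
    | succ k ih => simp only [Function.iterate_succ_apply']; exact glauber_odd hqneg ih
  have hstep := logConvex_succ_le
    (d := fun r => wmean w (fun x => (glauber q)^[r] u x * (glauber q)^[r] u x))
    (C := totalOsc u ^ 2 / 4) (r := ρ ^ 2) (fun k => hw.wmean_nonneg fun x => mul_self_nonneg _)
    (fun k => ?_) (by positivity) (fun k => ?_)
  · simp only [Function.iterate_one, Function.iterate_zero, id] at hstep
    have hcs := wmean_sq_le hw.nonneg u (glauber q u)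
    have hnn : 0 ≤ wmean w (fun x => u x * u x) := hw.wmean_nonneg fun x => mul_self_nonneg _
    -- Log-convexity gave `‖P u‖² ≤ ρ² ‖u‖²`; Cauchy–Schwarz turns it into a bound on `⟨u, P u⟩`,
    -- hence into the spectral gap `1 - ρ = (1 - α) / n`.
    have h1 : wmean w (fun x => u x * glauber q u x) ≤ ρ * wmean w (fun x => u x * u x) := by
      refine abs_le_of_sq_le_sq' ?_ (by positivity) |>.2
      calc _ ≤ _ := hcs
        _ ≤ wmean w (fun x => u x * u x) * (ρ ^ 2 * wmean w (fun x => u x * u x)) := by gcongr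
        _ = _ := by ring
    rw [hw.dirichlet_eq hD.update_self hn0, le_div_iff₀ (by linarith)]
    have h2 : 1 - α = n * (1 - ρ) := by rw [hρdef, contractionRate]; field_simp; ring
    rw [h2]
    nlinarith
  · have := wmean_sq_le hw.nonneg ((glauber q)^[k] u) ((glauber q)^[k + 2] u)
    have e : wmean w (fun x => (glauber q)^[k] u x * (glauber q)^[k + 2] u x) =
        wmean w (fun x => (glauber q)^[k + 1] u x * (glauber q)^[k + 1] u x) := by
      simp only [Function.iterate_succ_apply']
      exact hw.wmean_mul_glauber hD.update_self hn0 _ _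
    rwa [e] at this
  · rw [← hw.wmean_const (totalOsc u ^ 2 / 4 * (ρ ^ 2) ^ k)]
    refine hw.wmean_mono fun x => ?_
    have h1 := abs_le_totalOsc_of_odd (hoddk k) x
    have h2 := hD.totalOsc_iterate_le hn0 u k
    have h3 : |(glauber q)^[k] u x| ≤ ρ ^ k * totalOsc u / 2 := by linarith
    calc _ = |(glauber q)^[k] u x| ^ 2 := by rw [sq_abs, sq]
      _ ≤ (ρ ^ k * totalOsc u / 2) ^ 2 := by gcongr
      _ = _ := by ring

lemma wmean_abs_le (hw : IsReversible w q) (u : SpinConfig n → ℝ) :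
    wmean w (fun x => |u x|) ^ 2 ≤ wmean w (fun x => u x * u x) := by
  have := wmean_sq_le hw.nonneg (fun x => |u x|) (fun _ => 1)
  simpa [hw.wmean_const] using this

/-- The average size of the derivatives of `P ^ r f`, for an even `f` with bounded second
derivatives. -/
lemma IsReversible.sum_wmean_abs_spinDiff_le (hw : IsReversible w q) (hD : IsDobrushin q I α)
    (hn : 2 ≤ n) (hα : α < 1) (hqneg : ∀ i x, q i (-x) = 1 - q i x) {c : ℝ} (hc : 0 < c)
    (hcq : ∀ i x, c ≤ q i x * (1 - q i x)) {f : SpinConfig n → ℝ} (heven : ∀ x, f (-x) = f x)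
    {M : ℝ} (hM : 0 ≤ M) (hf : ∀ i k x, |spinDiff k (spinDiff i f) x| ≤ M) (r : ℕ) :
    ∑ i, wmean w (fun x => |spinDiff i ((glauber q)^[r] f) x|) ≤
      contractionRate n α ^ r * (M / (4 * √(c * (1 - α)))) * (n * √n) := by
  have hn0 : n ≠ 0 := by omega
  have hn' : (0 : ℝ) < n := by positivity
  have hα0 := hD.alpha_nonneg hn0
  set ρ := contractionRate n α with hρdef
  have hρ : 0 < ρ := by linarith [half_le_contractionRate hn hα0]
  have hα1 : 0 < 1 - α := by linarith
  -- Poincaré for each odd function `D_i f`; one factor `1/4` comes from `q (1 - q) ≤ 1/4` for `f`,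
  -- the other from the same bound for `D_i f`.
  have hdir0 : dirichlet w q f f ≤ n * (n * M ^ 2 / (16 * (1 - α))) := by
    calc dirichlet w q f f ≤ ∑ i : Fin n, n * M ^ 2 / (16 * (1 - α)) := by
          refine Finset.sum_le_sum fun i _ => ?_
          have hp := hw.wmean_sq_le_dirichlet hD hn hα hqneg (spinDiff_odd heven i)
          have hd := hw.dirichlet_le (spinDiff i f)
          have hs : ∑ k, spinOsc k (spinDiff i f) ^ 2 ≤ n * M ^ 2 := by
            calc _ ≤ ∑ k : Fin n, M ^ 2 := Finset.sum_le_sum fun k _ =>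
                  pow_le_pow_left₀ (spinOsc_nonneg _ _) (spinOsc_le (hf i k)) 2
              _ = _ := by simp
          calc wmean w (fun x => q i x * (1 - q i x) * (spinDiff i f x * spinDiff i f x))
              ≤ wmean w (fun x => 1 / 4 * (spinDiff i f x * spinDiff i f x)) := by
                refine hw.wmean_mono fun x => ?_
                have h2 : q i x * (1 - q i x) ≤ 1 / 4 := by nlinarith [sq_nonneg (q i x - 1 / 2)]
                exact mul_le_mul_of_nonneg_right h2 (mul_self_nonneg _)
            _ = 1 / 4 * wmean w (fun x => spinDiff i f x * spinDiff i f x) := by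
                simp only [wmean, Finset.mul_sum]
                exact Finset.sum_congr rfl fun x _ => by ring
            _ ≤ 1 / 4 * ((n * M ^ 2 / 4) / (1 - α)) := by
                have : dirichlet w q (spinDiff i f) (spinDiff i f) / (1 - α) ≤
                  (n * M ^ 2 / 4) / (1 - α) := by gcongr; linarith
                linarith
            _ = _ := by field_simp; ring
      _ = _ := by simp
  have hdirr := hw.dirichlet_iterate_le hD hn f r
  set g := (glauber q)^[r] f with hg
  have hsq : c * ∑ i, wmean w (fun x => |spinDiff i g x|) ^ 2 ≤ dirichlet w q g g := by
    rw [Finset.mul_sum]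
    refine Finset.sum_le_sum fun i _ => ?_
    calc c * wmean w (fun x => |spinDiff i g x|) ^ 2
        ≤ c * wmean w (fun x => spinDiff i g x * spinDiff i g x) := by
          gcongr; exact wmean_abs_le hw _
      _ = wmean w (fun x => c * (spinDiff i g x * spinDiff i g x)) := by
          simp only [wmean, Finset.mul_sum]
          exact Finset.sum_congr rfl fun x _ => by ring
      _ ≤ _ := hw.wmean_mono fun x => mul_le_mul_of_nonneg_right (hcq i x) (mul_self_nonneg _)
  -- Cauchy–Schwarz over the nodes. With a Dirichlet form of order `n ^ 2` this gives `n ^ (3/2)`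
  -- for the sum, instead of `n ^ 2`.
  have hcs : (∑ i, wmean w (fun x => |spinDiff i g x|)) ^ 2 ≤
      n * ∑ i, wmean w (fun x => |spinDiff i g x|) ^ 2 := by
    simpa using sq_sum_le_card_mul_sum_sq (s := (Finset.univ : Finset (Fin n)))
      (f := fun i => wmean w (fun x => |spinDiff i g x|))
  refine abs_le_of_sq_le_sq' ?_ (by positivity) |>.2
  have hprod : c * (∑ i, wmean w (fun x => |spinDiff i g x|)) ^ 2 ≤
      n * ((ρ ^ 2) ^ r * (n * (n * M ^ 2 / (16 * (1 - α))))) := by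
    calc _ ≤ n * (c * ∑ i, wmean w (fun x => |spinDiff i g x|) ^ 2) := by nlinarith
      _ ≤ n * ((ρ ^ 2) ^ r * (n * (n * M ^ 2 / (16 * (1 - α))))) := by
          refine mul_le_mul_of_nonneg_left ((hsq.trans hdirr).trans ?_) hn'.le
          gcongr
  have hR : (ρ ^ r * (M / (4 * √(c * (1 - α)))) * (n * √n)) ^ 2 =
      (n * ((ρ ^ 2) ^ r * (n * (n * M ^ 2 / (16 * (1 - α)))))) / c := by
    rw [mul_pow, mul_pow, mul_pow, div_pow, mul_pow, Real.sq_sqrt (by positivity),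
      Real.sq_sqrt hn'.le]
    field_simp
    ring
  rw [hR, le_div_iff₀ hc]
  linarith

end Reversible

/-! ### Conditional probabilities as a Dobrushin system, and their second derivatives. -/

section CondProb

variable {n : ℕ}

/-- The conditional probability of the spin `+1`. -/
noncomputable def plusProb (π : SpinConfig n → ℝ) (i : Fin n) (x : SpinConfig n) : ℝ :=
  condProb π i x 1

variable {π : SpinConfig n → ℝ}

lemma sum_units_int (F : ℤˣ → ℝ) : ∑ s, F s = F 1 + F (-1) := by
  rw [UnitsInt.univ, Finset.sum_pair (by decide)]

lemma plusProb_eq (i : Fin n) (x : SpinConfig n) :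
    plusProb π i x = π (update x i 1) / (π (update x i 1) + π (update x i (-1))) := by
  rw [plusProb, condProb, sum_units_int]

lemma condProb_neg_one (hπ : ∀ x, 0 < π x) (i : Fin n) (x : SpinConfig n) :
    condProb π i x (-1) = 1 - plusProb π i x := by
  have h1 := hπ (update x i 1)
  have h2 := hπ (update x i (-1))
  rw [plusProb_eq, condProb, sum_units_int]
  field_simp; ring

lemma plusProb_update_self (i : Fin n) (x : SpinConfig n) (s : ℤˣ) :
    plusProb π i (update x i s) = plusProb π i x := by
  simp [plusProb_eq]

lemma plusProb_nonneg (hπ : ∀ x, 0 < π x) (i : Fin n) (x : SpinConfig n) :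
    0 ≤ plusProb π i x := by
  have h1 := hπ (update x i 1)
  have h2 := hπ (update x i (-1))
  rw [plusProb_eq]; positivity

lemma plusProb_le_one (hπ : ∀ x, 0 < π x) (i : Fin n) (x : SpinConfig n) :
    plusProb π i x ≤ 1 := by
  have h1 := hπ (update x i 1)
  have h2 := hπ (update x i (-1))
  rw [plusProb_eq, div_le_one (by positivity)]; linarith

lemma plusProb_neg (hπ : ∀ x, 0 < π x) (heven : ∀ x, π (-x) = π x) (i : Fin n)
    (x : SpinConfig n) : plusProb π i (-x) = 1 - plusProb π i x := by
  have h1 := hπ (update x i 1)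
  have h2 := hπ (update x i (-1))
  rw [plusProb_eq, plusProb_eq, update_neg, update_neg, heven, heven, neg_neg]
  field_simp; ring

lemma spinTV_condProb (hπ : ∀ x, 0 < π x) (i : Fin n) (x y : SpinConfig n) :
    spinTV (condProb π i x) (condProb π i y) = |plusProb π i x - plusProb π i y| := by
  rw [spinTV, sum_units_int, condProb_neg_one hπ, condProb_neg_one hπ,
    show (1 - plusProb π i x - (1 - plusProb π i y)) = -(plusProb π i x - plusProb π i y) by ring,
    abs_neg]
  simp only [plusProb]; ring

lemma abs_plusProb_sub_le (hπ : ∀ x, 0 < π x) {i j : Fin n} {x y : SpinConfig n}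
    (h : ∀ k, k ≠ j → x k = y k) : |plusProb π i x - plusProb π i y| ≤ influence π j i := by
  rw [← spinTV_condProb hπ]
  exact le_ciSup (f := fun z : {z : SpinConfig n × SpinConfig n // ∀ k, k ≠ j → z.1 k = z.2 k} =>
    spinTV (condProb π i z.1.1) (condProb π i z.1.2)) (Set.finite_range _).bddAbove ⟨(x, y), h⟩

lemma abs_spinDiff_plusProb_le (hπ : ∀ x, 0 < π x) (j i : Fin n) (x : SpinConfig n) :
    |spinDiff j (plusProb π i) x| ≤ influence π j i :=
  abs_plusProb_sub_le hπ fun k hk => by simp [hk]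

lemma isDobrushin_plusProb (hπ : ∀ x, 0 < π x) :
    IsDobrushin (plusProb π) (influence π) (dobrushin π) where
  update_self := plusProb_update_self
  nonneg := plusProb_nonneg hπ
  le_one := plusProb_le_one hπ
  abs_spinDiff_le := abs_spinDiff_plusProb_le hπ
  infl_nonneg j i := (abs_nonneg _).trans (abs_spinDiff_plusProb_le hπ j i 1)
  sum_infl_le i :=
    le_ciSup (f := fun i => ∑ j, influence π j i) (Set.finite_range _).bddAbove i

lemma isReversible_plusProb (hπ : ∀ x, 0 < π x) (hsum : ∑ x, π x = 1) :
    IsReversible π (plusProb π) where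
  nonneg x := (hπ x).le
  sum_eq_one := hsum
  mul_eq i x := by
    have h1 := hπ (update x i 1)
    have h2 := hπ (update x i (-1))
    rw [plusProb_eq]; field_simp

/-- Without external field, the conditional probabilities stay away from `0` and `1`. -/
lemma IsDobrushin.abs_two_mul_sub_one_le {q : Fin n → SpinConfig n → ℝ} {I : Fin n → Fin n → ℝ}
    {α : ℝ} (hD : IsDobrushin q I α) (hqneg : ∀ i x, q i (-x) = 1 - q i x) (i : Fin n)
    (x : SpinConfig n) : |2 * q i x - 1| ≤ α := by
  -- Flipping all spins exchanges `q` and `1 - q`, and costs at most the total influence on `i`.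
  have h := abs_sub_le_sum (q i) (fun j y => hD.abs_spinDiff_le j i y) (-x) x
  rw [hqneg, show q i x - (1 - q i x) = 2 * q i x - 1 by ring] at h
  refine h.trans (le_trans (Finset.sum_le_sum fun j _ => ?_) (hD.sum_infl_le i))
  split_ifs
  exacts [hD.infl_nonneg j i, le_rfl]

lemma IsDobrushin.le_q {q : Fin n → SpinConfig n → ℝ} {I : Fin n → Fin n → ℝ}
    {α : ℝ} (hD : IsDobrushin q I α) (hqneg : ∀ i x, q i (-x) = 1 - q i x) (i : Fin n)
    (x : SpinConfig n) : (1 - α) / 2 ≤ q i x := by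
  have := abs_le.1 (hD.abs_two_mul_sub_one_le hqneg i x)
  linarith

lemma IsDobrushin.le_one_sub_q {q : Fin n → SpinConfig n → ℝ} {I : Fin n → Fin n → ℝ}
    {α : ℝ} (hD : IsDobrushin q I α) (hqneg : ∀ i x, q i (-x) = 1 - q i x) (i : Fin n)
    (x : SpinConfig n) : (1 - α) / 2 ≤ 1 - q i x := by
  have := abs_le.1 (hD.abs_two_mul_sub_one_le hqneg i x)
  linarith

/-- The last factor depends on the odds ratio alone, which in a pairwise model is not affected by a
third spin. -/
lemma odds_sub_eq {a b c d : ℝ} (ha : 0 < a) (hb : 0 < b) (hc : 0 < c) (hd : 0 < d) :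
    a / (a + b) - c / (c + d) =
      a / (a + b) * (1 - c / (c + d)) * (1 - b * c / (a * d)) := by
  field_simp; ring

/-- The second derivatives of the conditional probabilities of a pairwise model: a product of two
influences. -/
lemma abs_spinDiff_spinDiff_plusProb_le (hπ : ∀ x, 0 < π x) {c : ℝ} (hc : 0 < c)
    (hq : ∀ i x, c ≤ plusProb π i x) (hq' : ∀ i x, c ≤ 1 - plusProb π i x)
    (hpair : ∀ i k m x, i ≠ k → i ≠ m → k ≠ m →
      spinDiff i (spinDiff k (spinDiff m (fun x => Real.log (π x)))) x = 0)
    (i k m : Fin n) (x : SpinConfig n) :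
    |spinDiff i (spinDiff k (plusProb π m)) x| ≤
      2 * influence π i m * influence π k m / c ^ 2 := by
  have hD := isDobrushin_plusProb hπ
  have hRHS : 0 ≤ 2 * influence π i m * influence π k m / c ^ 2 := by
    have := hD.infl_nonneg i m
    have := hD.infl_nonneg k m
    positivity
  have hself : spinDiff m (plusProb π m) = fun _ => 0 := by
    funext y; simp [spinDiff, plusProb_update_self]
  rcases eq_or_ne i k with rfl | hik
  · rwa [spinDiff_spinDiff_self, abs_zero]
  rcases eq_or_ne k m with rfl | hkm
  · rw [hself]; simpa [spinDiff] using hRHS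
  rcases eq_or_ne i m with rfl | him
  · rw [spinDiff_comm, hself]; simpa [spinDiff] using hRHS
  set f : ℤˣ → ℤˣ → ℝ := fun s t => plusProb π m (update (update x i s) k t) with hf
  have hpp : spinDiff i (spinDiff k (plusProb π m)) x =
      (f 1 1 - f (-1) 1) - (f 1 (-1) - f (-1) (-1)) := by
    simp only [spinDiff, hf]; ring
  have hI : ∀ t, |f 1 t - f (-1) t| ≤ influence π i m := fun t => by
    have := abs_spinDiff_plusProb_le hπ i m (update x k t)
    simpa [spinDiff, hf, Function.update_comm hik] using this
  have hK : ∀ s, |f s 1 - f s (-1)| ≤ influence π k m := fun s =>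
    abs_spinDiff_plusProb_le hπ k m (update x i s)
  set a : ℤˣ → ℤˣ → ℝ := fun s t => π (update (update (update x i s) k t) m 1) with ha
  set b : ℤˣ → ℤˣ → ℝ := fun s t => π (update (update (update x i s) k t) m (-1)) with hb
  have ha0 : ∀ s t, 0 < a s t := fun s t => hπ _
  have hb0 : ∀ s t, 0 < b s t := fun s t => hπ _
  have hab : ∀ s t, f s t = a s t / (a s t + b s t) := fun s t => plusProb_eq _ _
  have hlog := hpair i k m x hik him hkm
  set E : ℤˣ → ℝ := fun t => 1 - b 1 t * a (-1) t / (a 1 t * b (-1) t) with hE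
  have hdiff : ∀ t, f 1 t - f (-1) t = f 1 t * (1 - f (-1) t) * E t := fun t => by
    rw [hab, hab]
    exact odds_sub_eq (ha0 _ _) (hb0 _ _) (ha0 _ _) (hb0 _ _)
  -- The logarithm of the odds ratio for a flip of `i` has zero derivative in direction `k`, by the
  -- vanishing third derivative of `log π`.
  have hEE : E 1 = E (-1) := by
    simp only [hE]
    congr 1
    refine Real.log_injOn_pos ?_ ?_ ?_
    · have := ha0 1 1; have := ha0 (-1) 1; have := hb0 1 1; have := hb0 (-1) 1
      exact Set.mem_Ioi.2 (by positivity)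
    · have := ha0 1 (-1); have := ha0 (-1) (-1); have := hb0 1 (-1); have := hb0 (-1) (-1)
      exact Set.mem_Ioi.2 (by positivity)
    · have hA := fun s t => (ha0 s t).ne'
      have hB := fun s t => (hb0 s t).ne'
      rw [Real.log_div (mul_ne_zero (hB _ _) (hA _ _)) (mul_ne_zero (hA _ _) (hB _ _)),
        Real.log_div (mul_ne_zero (hB _ _) (hA _ _)) (mul_ne_zero (hA _ _) (hB _ _)),
        Real.log_mul (hB _ _) (hA _ _), Real.log_mul (hA _ _) (hB _ _),
        Real.log_mul (hB _ _) (hA _ _), Real.log_mul (hA _ _) (hB _ _)]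
      simp only [spinDiff] at hlog
      simp only [ha, hb]
      linarith
  have hfc : ∀ s t, c ≤ f s t := fun s t => hq _ _
  have hfc' : ∀ s t, c ≤ 1 - f s t := fun s t => hq' _ _
  -- So the second derivative is `E 1`, of size `I(i, m) / c²`, times the change with spin `k` of a
  -- product of probabilities, of size `2 I(k, m)`.
  have hE1 : c ^ 2 * |E 1| ≤ influence π i m := by
    refine le_trans ?_ (hI 1)
    rw [hdiff, abs_mul]
    refine mul_le_mul_of_nonneg_right ?_ (abs_nonneg _)
    rw [abs_of_nonneg (mul_nonneg (hc.le.trans (hfc _ _)) (hc.le.trans (hfc' _ _))), sq]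
    exact mul_le_mul (hfc _ _) (hfc' _ _) hc.le (hc.le.trans (hfc _ _))
  have hsecond : |f 1 1 * (1 - f (-1) 1) - f 1 (-1) * (1 - f (-1) (-1))| ≤
      2 * influence π k m := by
    rw [show f 1 1 * (1 - f (-1) 1) - f 1 (-1) * (1 - f (-1) (-1)) =
      (f 1 1 - f 1 (-1)) * (1 - f (-1) 1) - f 1 (-1) * (f (-1) 1 - f (-1) (-1)) by ring]
    refine (abs_sub _ _).trans ?_
    rw [abs_mul, abs_mul, two_mul]
    have h0 : ∀ s t, |f s t| ≤ 1 := fun s t =>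
      abs_le.2 ⟨by linarith [hfc s t], by linarith [hfc' s t]⟩
    have h1 : ∀ s t, |1 - f s t| ≤ 1 := fun s t =>
      abs_le.2 ⟨by linarith [hfc' s t], by linarith [hfc s t]⟩
    have hk0 := hD.infl_nonneg k m
    refine add_le_add ?_ ?_
    · calc _ ≤ influence π k m * 1 := mul_le_mul (hK 1) (h1 _ _) (abs_nonneg _) hk0
        _ = _ := mul_one _
    · calc _ ≤ 1 * influence π k m := mul_le_mul (h0 _ _) (hK (-1)) (abs_nonneg _) zero_le_one
        _ = _ := one_mul _
  rw [hpp, hdiff, hdiff, ← hEE, ← sub_mul, abs_mul, le_div_iff₀ (by positivity)]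
  calc _ = |f 1 1 * (1 - f (-1) 1) - f 1 (-1) * (1 - f (-1) (-1))| * (c ^ 2 * |E 1|) := by ring
    _ ≤ 2 * influence π k m * influence π i m :=
        mul_le_mul hsecond hE1 (by positivity) (by have := hD.infl_nonneg k m; positivity)
    _ = _ := by ring

lemma totalOsc₂_plusProb_le (hπ : ∀ x, 0 < π x) {c : ℝ} (hc : 0 < c)
    (hq : ∀ i x, c ≤ plusProb π i x) (hq' : ∀ i x, c ≤ 1 - plusProb π i x)
    (hpair : ∀ i k m x, i ≠ k → i ≠ m → k ≠ m →
      spinDiff i (spinDiff k (spinDiff m (fun x => Real.log (π x)))) x = 0) (m : Fin n) :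
    totalOsc₂ (plusProb π m) ≤ 2 * dobrushin π ^ 2 / c ^ 2 := by
  have hD := isDobrushin_plusProb hπ
  calc totalOsc₂ (plusProb π m)
      ≤ ∑ i, ∑ k, 2 * influence π i m * influence π k m / c ^ 2 := by
        refine Finset.sum_le_sum fun i _ => Finset.sum_le_sum fun k _ => ?_
        rw [spinOsc_spinDiff_comm]
        exact spinOsc_le fun x => abs_spinDiff_spinDiff_plusProb_le hπ hc hq hq' hpair i k m x
    _ = 2 * (∑ i, influence π i m) ^ 2 / c ^ 2 := by
        rw [sq (∑ i, influence π i m), Finset.sum_mul_sum, Finset.mul_sum, Finset.sum_div]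
        refine Finset.sum_congr rfl fun i _ => ?_
        rw [Finset.mul_sum, Finset.sum_div]
        exact Finset.sum_congr rfl fun k _ => by ring
    _ ≤ _ := by
        have h0 : 0 ≤ ∑ i, influence π i m := Finset.sum_nonneg fun i _ => hD.infl_nonneg i m
        gcongr
        exact hD.sum_infl_le m

end CondProb

/-! ### Linearity of the discrete derivative. -/

section Linear

variable {n : ℕ}

lemma spinDiff_add (i : Fin n) (u v : SpinConfig n → ℝ) :
    spinDiff i (fun x => u x + v x) = fun x => spinDiff i u x + spinDiff i v x := by
  funext x; simp only [spinDiff]; ring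

lemma spinDiff_sum {ι : Type*} (i : Fin n) (s : Finset ι) (F : ι → SpinConfig n → ℝ) :
    spinDiff i (fun x => ∑ e ∈ s, F e x) = fun x => ∑ e ∈ s, spinDiff i (F e) x := by
  funext x; simp only [spinDiff, Finset.sum_sub_distrib]

lemma spinDiff_const_mul (i : Fin n) (c : ℝ) (u : SpinConfig n → ℝ) :
    spinDiff i (fun x => c * u x) = fun x => c * spinDiff i u x := by
  funext x; simp only [spinDiff]; ring

end Linear

/-! ### The Ising law: positivity, spin-flip symmetry, vanishing third derivatives. -/

namespace IsingModel

variable {n : ℕ} (p : IsingModel n)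

lemma prob_pos (x : SpinConfig n) : 0 < p.prob x := Real.exp_pos _

lemma sum_prob : ∑ x, p.prob x = 1 := by
  have h : 0 < ∑ x : SpinConfig n, Real.exp (p.energy x) :=
    Finset.sum_pos (fun _ _ => Real.exp_pos _) Finset.univ_nonempty
  simp only [prob, Real.exp_sub, ← Finset.sum_div, logPartition, Real.exp_log h]
  exact div_self h.ne'

lemma spin_neg (x : SpinConfig n) (v : Fin n) : spin (-x) v = -spin x v := by
  simp [spin]

variable {p}

lemma NoExternalField.energy_neg (hp : p.NoExternalField) (x : SpinConfig n) :
    p.energy (-x) = p.energy x := by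
  simp only [energy, hp _, zero_mul, Finset.sum_const_zero, zero_add]
  refine Finset.sum_congr rfl fun e _ => ?_
  induction e using Sym2.ind with
  | _ u v => simp [spin_neg]

lemma NoExternalField.prob_neg (hp : p.NoExternalField) (x : SpinConfig n) :
    p.prob (-x) = p.prob x := by
  rw [prob, prob, hp.energy_neg]

-- Every term of the energy involves at most two nodes, so one of three derivatives in distinct
-- directions kills it.
open scoped Classical in
variable (p) in
lemma spinDiff_energy_eq_zero {i k m : Fin n} (_ : i ≠ k) (_ : i ≠ m) (_ : k ≠ m)
    (x : SpinConfig n) : spinDiff i (spinDiff k (spinDiff m p.energy)) x = 0 := by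
  have hspin : ∀ (y : SpinConfig n) (j v : Fin n) (s : ℤˣ),
      spin (update y j s) v = if v = j then ((s : ℤ) : ℝ) else spin y v := by
    intro y j v s
    rcases eq_or_ne v j with rfl | h <;> simp [spin, *]
  have hnode : ∀ v, spinDiff i (spinDiff k (spinDiff m fun x => spin x v)) x = 0 := by
    intro v
    simp only [spinDiff, hspin]
    split_ifs <;> simp_all
  have hedge : ∀ e : Sym2 (Fin n),
      spinDiff i (spinDiff k (spinDiff m fun x => (e.map (spin x)).mul)) x = 0 := by
    intro e
    induction e using Sym2.ind with
    | _ u v =>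
      simp only [spinDiff, Sym2.map_mk, Sym2.mul_mk, hspin]
      split_ifs <;> simp_all
  have hlin : p.energy = fun x => ∑ v, p.nodeParam v * (fun x => spin x v) x +
      ∑ e ∈ p.graph.edgeFinset, p.edgeParam e * (fun x => (e.map (spin x)).mul) x := rfl
  rw [hlin]
  simp only [spinDiff_add, spinDiff_sum, spinDiff_const_mul, hnode, hedge, mul_zero,
    Finset.sum_const_zero, add_zero]

lemma log_prob (x : SpinConfig n) : Real.log (p.prob x) = p.energy x - p.logPartition := by
  rw [prob, Real.log_exp]

variable (p) in
lemma spinDiff_log_prob_eq_zero (i k m : Fin n) (x : SpinConfig n) (hik : i ≠ k) (him : i ≠ m)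
    (hkm : k ≠ m) :
    spinDiff i (spinDiff k (spinDiff m fun x => Real.log (p.prob x))) x = 0 := by
  rw [← spinDiff_energy_eq_zero p hik him hkm x]
  congr 2
  funext y
  simp [spinDiff, log_prob]

end IsingModel

/-! ### Oscillations of the quadratic form. -/

section QuadForm

variable {n : ℕ} (a : {e : Fin n × Fin n // e.1 < e.2} → ℝ)

lemma quadForm_neg (x : SpinConfig n) : quadForm a (-x) = quadForm a x := by
  simp [quadForm, IsingModel.spin_neg]

lemma abs_spinDiff_spinDiff_quadForm_le_of_lt {i k : Fin n} (hik : i < k) (x : SpinConfig n) :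
    |spinDiff k (spinDiff i (quadForm a)) x| ≤ 4 * ‖a‖ := by
  have hspin : ∀ (y : SpinConfig n) (j v : Fin n) (s : ℤˣ),
      spin (update y j s) v = if v = j then ((s : ℤ) : ℝ) else spin y v := by
    intro y j v s
    rcases eq_or_ne v j with rfl | h <;> simp [spin, *]
  have hterm : ∀ e : {e : Fin n × Fin n // e.1 < e.2}, e ≠ ⟨(i, k), hik⟩ →
      spinDiff k (spinDiff i fun x => spin x e.1.1 * spin x e.1.2) x = 0 := by
    rintro ⟨⟨u, v⟩, huv⟩ hne
    have hne' : ¬ (u = i ∧ v = k) := fun h => hne (by simp [h.1, h.2])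
    have huv' : ¬ (u = k ∧ v = i) := fun h => by
      simp only [h.1, h.2] at huv; exact absurd huv hik.asymm
    have huv'' : u ≠ v := huv.ne
    simp only [spinDiff, hspin]
    split_ifs <;> simp_all
  have hlin : quadForm a = fun x => ∑ e, a e * (fun x => spin x e.1.1 * spin x e.1.2) x := by
    funext y; simp [quadForm, mul_assoc]
  rw [hlin]
  simp only [spinDiff_sum, spinDiff_const_mul]
  rw [Finset.sum_eq_single ⟨(i, k), hik⟩ (fun e _ he => by rw [hterm e he, mul_zero]) (by simp)]
  have : spinDiff k (spinDiff i fun x => spin x i * spin x k) x = 4 := by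
    simp [spinDiff, hspin, hik.ne']; norm_num
  rw [this, abs_mul, mul_comm]
  have := norm_le_pi_norm a ⟨(i, k), hik⟩
  rw [Real.norm_eq_abs] at this
  norm_num; linarith

lemma abs_spinDiff_spinDiff_quadForm_le (i k : Fin n) (x : SpinConfig n) :
    |spinDiff k (spinDiff i (quadForm a)) x| ≤ 4 * ‖a‖ := by
  rcases lt_trichotomy i k with h | rfl | h
  · exact abs_spinDiff_spinDiff_quadForm_le_of_lt a h x
  · rw [spinDiff_spinDiff_self, abs_zero]; positivity
  · rw [spinDiff_comm]; exact abs_spinDiff_spinDiff_quadForm_le_of_lt a h x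

lemma totalOsc₂_quadForm_le : totalOsc₂ (quadForm a) ≤ n ^ 2 * (4 * ‖a‖) := by
  calc totalOsc₂ (quadForm a) ≤ ∑ _i : Fin n, ∑ _k : Fin n, 4 * ‖a‖ :=
        Finset.sum_le_sum fun i _ => Finset.sum_le_sum fun k _ =>
          spinOsc_le (abs_spinDiff_spinDiff_quadForm_le a i k)
    _ = _ := by simp; ring

/-- The first derivatives of an even function are odd, so they are controlled by the second ones. -/
lemma totalOsc_quadForm_le : totalOsc (quadForm a) ≤ n ^ 2 * (2 * ‖a‖) := by
  calc totalOsc (quadForm a) ≤ ∑ i, totalOsc (spinDiff i (quadForm a)) / 2 :=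
        Finset.sum_le_sum fun i _ => spinOsc_le fun x =>
          abs_le_totalOsc_of_odd (spinDiff_odd (quadForm_neg a) i) x
    _ = totalOsc₂ (quadForm a) / 2 := by rw [← Finset.sum_div]; rfl
    _ ≤ _ := by linarith [totalOsc₂_quadForm_le a]

end QuadForm

instance : DiscreteMeasurableSpace ℤˣ :=
  ⟨fun s => ⟨Units.val '' s, trivial, Set.preimage_image_eq s Units.val_injective⟩⟩

/-! ### Measurability of one update and of a stale read. -/

section Measurability

variable {n : ℕ} {π : SpinConfig n → ℝ} {Ω : Type*} [MeasurableSpace Ω]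

lemma measurable_greedy_update {y z : Ω → SpinConfig n} {i : Ω → Fin n} {u : Ω → ℝ}
    (hy : Measurable y) (hz : Measurable z) (hi : Measurable i) (hu : Measurable u) :
    Measurable fun ω => update (y ω) (i ω) (greedyDraw (condProb π (i ω) (z ω) 1) (u ω)) := by
  have hc : Measurable fun ω => condProb π (i ω) (z ω) 1 :=
    (Measurable.of_discrete (f := fun a : Fin n × SpinConfig n => condProb π a.1 a.2 1)).comp
      (hi.prodMk hz)
  have hd : Measurable fun ω => greedyDraw (condProb π (i ω) (z ω) 1) (u ω) :=
    Measurable.ite (measurableSet_le hu hc) measurable_const measurable_const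
  exact (Measurable.of_discrete
    (f := fun a : SpinConfig n × Fin n × ℤˣ => update a.1 a.2.1 a.2.2)).comp
      (hy.prodMk (hi.prodMk hd))

lemma measurable_stale_read {g : ℕ → Ω → SpinConfig n} {d : Fin n → Ω → ℕ} {s : ℕ}
    (hg : ∀ v ≤ s, Measurable (g v)) (hd : ∀ j, Measurable (d j)) :
    Measurable fun ω j => g (s - d j ω) ω j := by
  refine measurable_pi_lambda _ fun j => ?_
  have h : Measurable fun a : ℕ × Ω => g (s - a.1) a.2 j :=
    measurable_from_prod_countable_right fun v =>
      (measurable_pi_apply j).comp (hg _ (Nat.sub_le s v))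
  exact h.comp ((hd j).prodMk measurable_id)

lemma integrable_of_abs_le {μ : Measure Ω} [IsFiniteMeasure μ] {f : Ω → ℝ} (hf : Measurable f)
    {C : ℝ} (hC : ∀ ω, |f ω| ≤ C) : Integrable f μ :=
  Integrable.of_bound hf.aestronglyMeasurable C (Filter.Eventually.of_forall hC)

end Measurability

/-! ### Adaptedness of the chains, and independence of the update from the past. -/

namespace GreedyCoupling

variable {n : ℕ} {τ : ℝ} {Ω : Type*} [mΩ : MeasurableSpace Ω] {μ : Measure Ω}
  (K : GreedyCoupling n τ μ) (π : SpinConfig n → ℝ)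

/-- The state that is read by the HOGWILD! chain in step `s + 1`. -/
noncomputable def staleRead (s : ℕ) (ω : Ω) : SpinConfig n :=
  fun j => K.hog π (s - K.delay (s + 1) j ω) ω j

lemma hog_zero (ω : Ω) : K.hog π 0 ω = K.init ω := by
  simp [hog, hogwildRun]

lemma hog_succ (s : ℕ) (ω : Ω) :
    K.hog π (s + 1) ω = update (K.hog π s ω) (K.node (s + 1) ω)
      (greedyDraw (condProb π (K.node (s + 1) ω) (K.staleRead π s ω) 1) (K.unif (s + 1) ω)) := by
  simp only [hog]
  rw [hogwildRun]
  rfl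

lemma seq_succ (s : ℕ) (ω : Ω) :
    K.seq π (s + 1) ω = update (K.seq π s ω) (K.node (s + 1) ω)
      (greedyDraw (condProb π (K.node (s + 1) ω) (K.seq π s ω) 1) (K.unif (s + 1) ω)) := rfl

/-- The past of step `s + 1`, together with the delays of that step. -/
abbrev past (s : ℕ) : MeasurableSpace Ω :=
  K.ℱ s ⊔ ⨆ i, MeasurableSpace.comap (K.delay (s + 1) i) inferInstance

lemma filtration_le_past (s : ℕ) : K.ℱ s ≤ K.past s := le_sup_left

lemma past_le (s : ℕ) : K.past s ≤ mΩ :=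
  sup_le (K.ℱ.le s) (iSup_le fun i => Measurable.comap_le
    ((K.delay_meas s i).mono (K.ℱ.le _) le_rfl))

lemma measurable_delay_past (s : ℕ) (i : Fin n) : Measurable[K.past s] (K.delay (s + 1) i) :=
  (comap_measurable _).mono ((le_iSup (fun i =>
    MeasurableSpace.comap (K.delay (s + 1) i) inferInstance) i).trans le_sup_right) le_rfl

lemma measurable_hog (s : ℕ) : Measurable[K.ℱ s] (K.hog π s) := by
  induction s using Nat.strong_induction_on with
  | _ s ih =>
    cases s with
    | zero =>
      rw [show K.hog π 0 = K.init from funext (K.hog_zero π)]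
      exact K.init_meas
    | succ s =>
      have hle : ∀ v ≤ s, Measurable[K.ℱ (s + 1)] (K.hog π v) := fun v hv =>
        (ih v (by omega)).mono (K.ℱ.mono (by omega)) le_rfl
      rw [show K.hog π (s + 1) = _ from funext (K.hog_succ π s)]
      exact @measurable_greedy_update _ _ _ (K.ℱ (s + 1)) _ _ _ _ (hle s le_rfl)
        (@measurable_stale_read _ _ (K.ℱ (s + 1)) _ _ _ hle (K.delay_meas s))
        (K.node_meas s) (K.unif_meas s)

lemma measurable_staleRead (s : ℕ) : Measurable[K.past s] (K.staleRead π s) :=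
  @measurable_stale_read _ _ (K.past s) _ _ _
    (fun v hv => (K.measurable_hog π v).mono ((K.ℱ.mono hv).trans (K.filtration_le_past s)) le_rfl)
    (K.measurable_delay_past s)

lemma measurable_seq (s : ℕ) : Measurable[K.ℱ s] (K.seq π s) := by
  induction s with
  | zero => exact K.init_meas
  | succ s ih =>
    rw [show K.seq π (s + 1) = _ from funext (K.seq_succ π s)]
    have := ih.mono (K.ℱ.mono (Nat.le_succ s)) le_rfl
    exact @measurable_greedy_update _ _ _ (K.ℱ (s + 1)) _ _ _ _ this this
        (K.node_meas s) (K.unif_meas s)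

lemma measurable_update (s : ℕ) :
    Measurable fun ω => (K.node (s + 1) ω, K.unif (s + 1) ω) :=
  ((K.node_meas s).mono (K.ℱ.le _) le_rfl).prodMk ((K.unif_meas s).mono (K.ℱ.le _) le_rfl)

lemma card_ne_zero (K : GreedyCoupling n τ μ) [NeZero μ] : n ≠ 0 := by
  have : Nonempty Ω := by
    by_contra h
    rw [not_nonempty_iff] at h
    exact NeZero.ne μ (Measure.eq_zero_of_isEmpty μ)
  rintro rfl
  exact (K.node 0 this.some).elim0

lemma tau_nonneg (K : GreedyCoupling n τ μ) [IsProbabilityMeasure μ] : 0 ≤ τ := by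
  have hn := K.card_ne_zero
  have h := K.delay_mean 0 ⟨0, Nat.pos_of_ne_zero hn⟩
  have h1 := integral_mono_ae integrable_condExp (integrable_const τ) h
  rw [integral_condExp (K.ℱ.le 0)] at h1
  simp only [integral_const, probReal_univ, smul_eq_mul, one_mul] at h1
  exact (integral_nonneg fun ω => Nat.cast_nonneg _).trans h1

lemma integral_mul_indicator_update (s : ℕ) {A : Ω → ℝ} (hA : Measurable[K.past s] A)
    {T : Set (Fin n × ℝ)} (hT : MeasurableSet T) :
    ∫ ω, A ω * T.indicator 1 (K.node (s + 1) ω, K.unif (s + 1) ω) ∂μ =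
      (∫ ω, A ω ∂μ) *
        ((uniformOn (Set.univ : Set (Fin n))).prod (volume.restrict (Set.Icc (0 : ℝ) 1))).real
          T := by
  have hU := K.measurable_update s
  have hind : IndepFun A
      (fun ω => T.indicator (1 : Fin n × ℝ → ℝ) (K.node (s + 1) ω, K.unif (s + 1) ω)) μ := by
    have h1 : IndepFun (fun ω => (K.node (s + 1) ω, K.unif (s + 1) ω)) A μ :=
      (IndepFun_iff_Indep _ _ _).2 (indep_of_indep_of_le_right (K.update_indep s) hA.comap_le)
    exact h1.symm.comp measurable_id (measurable_one.indicator hT)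
  have hm : Measurable fun ω =>
      T.indicator (1 : Fin n × ℝ → ℝ) (K.node (s + 1) ω, K.unif (s + 1) ω) :=
    (measurable_one.indicator hT).comp hU
  have := hind.integral_mul_eq_mul_integral (hA.mono (K.past_le s) le_rfl).aestronglyMeasurable
    hm.aestronglyMeasurable
  simp only [Pi.mul_apply] at this
  rw [this, ← K.update_law s]
  congr 1
  rw [map_measureReal_apply hU hT, ← integral_indicator_one (hU hT)]
  rfl

lemma integral_mul_node_eq [IsProbabilityMeasure μ]
    (s : ℕ) {A : Ω → ℝ} (hA : Measurable[K.past s] A) (j : Fin n) :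
    ∫ ω, A ω * (if K.node (s + 1) ω = j then 1 else 0) ∂μ = (∫ ω, A ω ∂μ) / n := by
  have hn := K.card_ne_zero
  have hT : MeasurableSet ({j} ×ˢ Set.univ : Set (Fin n × ℝ)) :=
    (measurableSet_singleton j).prod MeasurableSet.univ
  have h := K.integral_mul_indicator_update s hA hT
  have h1 : ((uniformOn (Set.univ : Set (Fin n))).prod
      (volume.restrict (Set.Icc (0 : ℝ) 1))).real ({j} ×ˢ Set.univ) = 1 / n := by
    rw [measureReal_def, Measure.prod_prod, uniformOn_univ]
    simp
  rw [h1] at h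
  simp only [Set.indicator, Set.mem_prod, Set.mem_singleton_iff, Set.mem_univ, and_true,
    Pi.one_apply] at h
  rw [h]; ring

lemma integral_mul_node_unif (s : ℕ) {A : Ω → ℝ} (hA : Measurable[K.past s] A) (j : Fin n)
    {c : ℝ} (h0 : 0 ≤ c) (h1 : c ≤ 1) :
    ∫ ω, A ω * (if K.node (s + 1) ω = j ∧ K.unif (s + 1) ω ≤ c then 1 else 0) ∂μ =
      (∫ ω, A ω ∂μ) * c / n := by
  have hT : MeasurableSet ({j} ×ˢ Set.Iic c : Set (Fin n × ℝ)) :=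
    (measurableSet_singleton j).prod measurableSet_Iic
  have h := K.integral_mul_indicator_update s hA hT
  have h2 : ((uniformOn (Set.univ : Set (Fin n))).prod
      (volume.restrict (Set.Icc (0 : ℝ) 1))).real ({j} ×ˢ Set.Iic c) = c / n := by
    rw [measureReal_def, Measure.prod_prod, uniformOn_univ,
      Measure.restrict_apply measurableSet_Iic]
    have : Set.Iic c ∩ Set.Icc 0 1 = Set.Icc 0 c := by
      ext x; simp only [Set.mem_inter_iff, Set.mem_Iic, Set.mem_Icc]
      constructor
      · rintro ⟨h, h', -⟩; exact ⟨h', h⟩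
      · rintro ⟨h, h'⟩; exact ⟨h', h, h'.trans h1⟩
    rw [this]
    simp [ENNReal.toReal_ofReal h0]
    ring
  rw [h2] at h
  simp only [Set.indicator, Set.mem_prod, Set.mem_singleton_iff, Set.mem_Iic,
    Pi.one_apply] at h
  rw [h]; ring

end GreedyCoupling

lemma exists_abs_le {E : Type*} [Finite E] (F : E → ℝ) : ∃ C, ∀ e, |F e| ≤ C := by
  obtain ⟨C, hC⟩ := (Set.finite_range fun e => |F e|).bddAbove
  exact ⟨C, fun e => hC ⟨e, rfl⟩⟩

/-! ### One greedy step, and the staleness weight. -/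

namespace GreedyCoupling

variable {n : ℕ} {τ : ℝ} {Ω : Type*} [mΩ : MeasurableSpace Ω] {μ : Measure Ω}
  (K : GreedyCoupling n τ μ) {π : SpinConfig n → ℝ}

/-- One greedy step at node `j`. -/
lemma integral_greedy_step [IsProbabilityMeasure μ]
    (hπ : ∀ x, 0 < π x) (s : ℕ) (j : Fin n) {W : Ω → ℝ}
    (hW : Measurable[K.past s] W) {C : ℝ} (hC : ∀ ω, |W ω| ≤ C) {y z : Ω → SpinConfig n}
    (hy : Measurable[K.past s] y) (hz : Measurable[K.past s] z) (h : SpinConfig n → ℝ) :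
    ∫ ω, W ω * h (update (y ω) (K.node (s + 1) ω)
        (greedyDraw (condProb π (K.node (s + 1) ω) (z ω) 1) (K.unif (s + 1) ω))) *
        (if K.node (s + 1) ω = j then 1 else 0) ∂μ =
      (∫ ω, W ω * (h (update (y ω) j (-1)) + plusProb π j (z ω) * spinDiff j h (y ω)) ∂μ) / n := by
  classical
  have hle := K.past_le s
  have hmd : ∀ F : SpinConfig n → ℝ, Measurable F := fun F => Measurable.of_discrete
  set A : Ω → ℝ := fun ω => W ω * h (update (y ω) j (-1)) with hA
  -- The threshold for `unif` depends on the random state `z`. Splitting over the finitely many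
  -- values `z₀` freezes it, so that independence applies to events `unif ≤ constant`.
  set B : SpinConfig n → Ω → ℝ := fun z₀ ω =>
    W ω * spinDiff j h (y ω) * (if z ω = z₀ then 1 else 0) with hB
  have hAm : Measurable[K.past s] A :=
    hW.mul ((hmd fun x => h (update x j (-1))).comp hy)
  have hBm : ∀ z₀, Measurable[K.past s] (B z₀) := fun z₀ =>
    (hW.mul ((hmd (spinDiff j h)).comp hy)).mul
      ((hmd fun x => if x = z₀ then 1 else 0).comp hz)
  have hC0 : 0 ≤ C := (abs_nonneg _).trans (hC (Classical.choice (by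
    by_contra hne
    rw [not_nonempty_iff] at hne
    exact NeZero.ne μ (Measure.eq_zero_of_isEmpty μ))))
  obtain ⟨C1, hC1⟩ := exists_abs_le fun x : SpinConfig n => h (update x j (-1))
  obtain ⟨C2, hC2⟩ := exists_abs_le (spinDiff j h)
  have hAb : ∀ ω, |A ω| ≤ C * C1 := fun ω => by
    rw [hA, abs_mul]; exact mul_le_mul (hC ω) (hC1 _) (abs_nonneg _) hC0
  have hBb : ∀ z₀ ω, |B z₀ ω| ≤ C * C2 := fun z₀ ω => by
    simp only [hB]
    rw [abs_mul, abs_mul]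
    have h1 : |W ω| * |spinDiff j h (y ω)| ≤ C * C2 :=
      mul_le_mul (hC ω) (hC2 _) (abs_nonneg _) hC0
    split_ifs
    · simpa using h1
    · simpa using (mul_nonneg (abs_nonneg _) (abs_nonneg _)).trans h1
  have hnode : Measurable (K.node (s + 1)) := (K.node_meas s).mono (K.ℱ.le _) le_rfl
  have hunif : Measurable (K.unif (s + 1)) := (K.unif_meas s).mono (K.ℱ.le _) le_rfl
  have hns : MeasurableSet {ω | K.node (s + 1) ω = j} := hnode (measurableSet_singleton j)
  have hus : ∀ c : ℝ, MeasurableSet {ω | K.node (s + 1) ω = j ∧ K.unif (s + 1) ω ≤ c} := fun c =>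
    hns.inter (measurableSet_le hunif measurable_const)
  have hAi : Integrable (fun ω => A ω * (if K.node (s + 1) ω = j then 1 else 0)) μ := by
    refine integrable_of_abs_le (C := C * C1) ((hAm.mono hle le_rfl).mul
      (Measurable.ite hns measurable_const measurable_const)) fun ω => ?_
    split_ifs
    · simpa using hAb ω
    · simpa using (abs_nonneg _).trans (hAb ω)
  have hBi : ∀ z₀, Integrable (fun ω => B z₀ ω *
      (if K.node (s + 1) ω = j ∧ K.unif (s + 1) ω ≤ plusProb π j z₀ then 1 else 0)) μ := by
    intro z₀
    refine integrable_of_abs_le (C := C * C2) (((hBm z₀).mono hle le_rfl).mul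
      (Measurable.ite (hus _) measurable_const measurable_const)) fun ω => ?_
    split_ifs
    · simpa using hBb z₀ ω
    · simpa using (abs_nonneg _).trans (hBb z₀ ω)
  have hBi' : ∀ z₀, Integrable (fun ω => B z₀ ω * plusProb π j z₀) μ := fun z₀ =>
    (integrable_of_abs_le ((hBm z₀).mono hle le_rfl) (hBb z₀)).mul_const _
  have hLHS : ∀ ω, W ω * h (update (y ω) (K.node (s + 1) ω)
      (greedyDraw (condProb π (K.node (s + 1) ω) (z ω) 1) (K.unif (s + 1) ω))) *
      (if K.node (s + 1) ω = j then 1 else 0) =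
      A ω * (if K.node (s + 1) ω = j then 1 else 0) + ∑ z₀, B z₀ ω *
        (if K.node (s + 1) ω = j ∧ K.unif (s + 1) ω ≤ plusProb π j z₀ then 1 else 0) := by
    intro ω
    have hsum : ∑ z₀, B z₀ ω *
        (if K.node (s + 1) ω = j ∧ K.unif (s + 1) ω ≤ plusProb π j z₀ then (1 : ℝ) else 0) =
        W ω * spinDiff j h (y ω) * (if K.node (s + 1) ω = j ∧
          K.unif (s + 1) ω ≤ plusProb π j (z ω) then 1 else 0) := by
      rw [Finset.sum_eq_single (z ω)]
      · simp [hB]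
      · intro b _ hb; simp [hB, hb.symm]
      · simp
    rw [hsum]
    by_cases hj : K.node (s + 1) ω = j
    · simp only [hj, true_and, if_true, mul_one, hA, greedyDraw, plusProb]
      split_ifs
      · simp only [spinDiff]; ring
      · ring
    · simp [hj]
  have hRHS : ∀ ω, W ω * (h (update (y ω) j (-1)) + plusProb π j (z ω) * spinDiff j h (y ω)) =
      A ω + ∑ z₀, B z₀ ω * plusProb π j z₀ := by
    intro ω
    have hsum : ∑ z₀, B z₀ ω * plusProb π j z₀ =
        W ω * spinDiff j h (y ω) * plusProb π j (z ω) := by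
      rw [Finset.sum_eq_single (z ω)]
      · simp [hB]
      · intro b _ hb; simp [hB, hb.symm]
      · simp
    rw [hsum, hA]; ring
  simp_rw [hLHS, hRHS]
  rw [integral_add hAi (integrable_finsetSum _ fun z₀ _ => hBi z₀),
    integral_finsetSum _ fun z₀ _ => hBi z₀,
    integral_add (integrable_of_abs_le (hAm.mono hle le_rfl) hAb)
      (integrable_finsetSum _ fun z₀ _ => hBi' z₀),
    integral_finsetSum _ fun z₀ _ => hBi' z₀, K.integral_mul_node_eq s hAm, add_div,
    Finset.sum_div]
  congr 1
  refine Finset.sum_congr rfl fun z₀ _ => ?_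
  rw [K.integral_mul_node_unif s (hBm z₀) j (plusProb_nonneg hπ _ _) (plusProb_le_one hπ _ _),
    integral_mul_const]

/-- A weight, known at time `s`, whose product with the delay of the read of node `j` is at least
`1` whenever that read is out of date. -/
noncomputable def kappa (s : ℕ) (j : Fin n) (ω : Ω) : ℝ :=
  1 / n + ∑ l ∈ Finset.range (min n s), if K.node (s - l) ω = j then 1 / ((l : ℝ) + 1) else 0

/-- One plus the `n`-th harmonic number. -/
noncomputable def logBound (n : ℕ) : ℝ := 1 + ∑ l ∈ Finset.range n, 1 / ((l : ℝ) + 1)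

/-- Only `l < s` matters: `node 0` is not an update, and for `d ≥ s` truncated subtraction returns
the initial state, as the reads do. -/
lemma hog_sub_eq (s : ℕ) (j : Fin n) (ω : Ω) (d : ℕ)
    (h : ∀ l, l < d → l < s → K.node (s - l) ω ≠ j) :
    K.hog π (s - d) ω j = K.hog π s ω j := by
  induction d with
  | zero => simp
  | succ d ih =>
    rw [← ih fun l hl => h l (by omega)]
    rcases lt_or_ge d s with hd | hd
    · have e : s - d = (s - (d + 1)) + 1 := by omega
      have hne := h d (by omega) hd
      rw [e] at hne ⊢
      rw [hog_succ, Function.update_of_ne hne.symm]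
    · rw [show s - (d + 1) = s - d by omega]

lemma kappa_nonneg (s : ℕ) (j : Fin n) (ω : Ω) : 0 ≤ K.kappa s j ω := by
  refine add_nonneg (by positivity) (Finset.sum_nonneg fun l _ => ?_)
  split_ifs <;> positivity

/-- An outdated read missed an update of `j` at some time `s - l` with `l <` delay. If `l < n`, that
update contributes `1 / (l + 1)` to `kappa`; otherwise the delay exceeds `n` and the summand `1 / n`
suffices. The cutoff at `n` keeps the mean of `kappa` at order `log n / n`. -/
lemma one_le_delay_mul_kappa (hn : n ≠ 0) (s : ℕ) (j : Fin n) (ω : Ω)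
    (h : K.staleRead π s ω j ≠ K.hog π s ω j) :
    1 ≤ (K.delay (s + 1) j ω : ℝ) * K.kappa s j ω := by
  have hn' : (0 : ℝ) < n := by positivity
  have hex : ∃ l, l < K.delay (s + 1) j ω ∧ l < s ∧ K.node (s - l) ω = j := by
    by_contra! hcon
    exact h (K.hog_sub_eq s j ω _ hcon)
  obtain ⟨l, hld, hls, hlj⟩ := hex
  have hd : (l : ℝ) + 1 ≤ K.delay (s + 1) j ω := by exact_mod_cast hld
  have hnn : ∀ l ∈ Finset.range (min n s),
      (0 : ℝ) ≤ if K.node (s - l) ω = j then 1 / ((l : ℝ) + 1) else 0 := fun l _ => by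
    split_ifs <;> positivity
  rcases lt_or_ge l n with hln | hln
  · have h1 : 1 / ((l : ℝ) + 1) ≤ K.kappa s j ω := by
      have := Finset.single_le_sum hnn (Finset.mem_range.2 (lt_min hln hls))
      rw [if_pos hlj] at this
      unfold kappa
      have : (0 : ℝ) ≤ 1 / n := by positivity
      linarith
    calc (1 : ℝ) = (l + 1) * (1 / (l + 1)) := by field_simp
      _ ≤ _ := mul_le_mul hd h1 (by positivity) (by positivity)
  · have h1 : 1 / (n : ℝ) ≤ K.kappa s j ω := by
      have := Finset.sum_nonneg hnn
      unfold kappa; linarith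
    have h2 : (n : ℝ) ≤ l := by exact_mod_cast hln
    calc (1 : ℝ) = n * (1 / n) := by field_simp
      _ ≤ _ := mul_le_mul (by linarith) h1 (by positivity) (by positivity)

lemma measurable_kappa (s : ℕ) (j : Fin n) : Measurable[K.ℱ s] (K.kappa s j) := by
  refine Measurable.add measurable_const (Finset.measurable_fun_sum _ fun l hl => ?_)
  have hl' := Finset.mem_range.1 hl
  have e : s - l = (s - l - 1) + 1 := by omega
  rw [e]
  have hm : Measurable[K.ℱ s] (K.node (s - l - 1 + 1)) :=
    (K.node_meas _).mono (K.ℱ.mono (by omega)) le_rfl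
  exact Measurable.ite (hm (measurableSet_singleton j)) measurable_const measurable_const

lemma kappa_le (s : ℕ) (j : Fin n) (ω : Ω) : K.kappa s j ω ≤ 1 / n + n := by
  unfold kappa
  gcongr
  calc _ ≤ ∑ l ∈ Finset.range (min n s), (1 : ℝ) := by
        refine Finset.sum_le_sum fun l _ => ?_
        split_ifs
        · rw [div_le_one (by positivity)]; linarith [(Nat.cast_nonneg l : (0 : ℝ) ≤ l)]
        · exact zero_le_one
    _ = (min n s : ℕ) := by simp
    _ ≤ n := by exact_mod_cast min_le_left n s

/-- The delays have conditional mean at most `τ`. -/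
lemma integral_mul_delay_le [IsProbabilityMeasure μ]
    (s : ℕ) (j : Fin n) {V : Ω → ℝ} (hV : Measurable[K.ℱ s] V)
    (hV0 : ∀ ω, 0 ≤ V ω) {C : ℝ} (hC : ∀ ω, V ω ≤ C) :
    Integrable (fun ω => V ω * K.delay (s + 1) j ω) μ ∧
      ∫ ω, V ω * K.delay (s + 1) j ω ∂μ ≤ τ * ∫ ω, V ω ∂μ := by
  have hVabs : ∀ ω, |V ω| ≤ C := fun ω => by rw [abs_of_nonneg (hV0 ω)]; exact hC ω
  have hVm := hV.mono (K.ℱ.le s) le_rfl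
  have hVi : Integrable V μ := integrable_of_abs_le hVm hVabs
  have hint : Integrable (V * fun ω => (K.delay (s + 1) j ω : ℝ)) μ :=
    (K.delay_integrable s j).bdd_mul hVm.aestronglyMeasurable
      (Filter.Eventually.of_forall fun ω => by rw [Real.norm_eq_abs]; exact hVabs ω)
  refine ⟨hint, ?_⟩
  have h1 := condExp_mul_of_stronglyMeasurable_left hV.stronglyMeasurable hint
    (K.delay_integrable s j)
  have h2 : ∫ ω, V ω * K.delay (s + 1) j ω ∂μ =
      ∫ ω, (V * μ[fun ω => (K.delay (s + 1) j ω : ℝ) | K.ℱ s]) ω ∂μ := by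
    rw [← integral_congr_ae h1, integral_condExp (K.ℱ.le s)]
    rfl
  rw [h2, ← integral_const_mul]
  refine integral_mono_ae ?_ (hVi.const_mul τ) ?_
  · exact integrable_condExp.congr h1
  · filter_upwards [K.delay_mean s j] with ω hω
    rw [Pi.mul_apply, mul_comm]
    exact mul_le_mul_of_nonneg_right hω (hV0 ω)

end GreedyCoupling

/-! ### Comparison of both chains with the Gibbs operator. -/

namespace GreedyCoupling

variable {n : ℕ} {τ : ℝ} {Ω : Type*} [mΩ : MeasurableSpace Ω] {μ : Measure Ω}
  (K : GreedyCoupling n τ μ) {π : SpinConfig n → ℝ}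

lemma measurable_comp_hog {s : ℕ} (F : SpinConfig n → ℝ) :
    Measurable[K.ℱ s] fun ω => F (K.hog π s ω) :=
  (Measurable.of_discrete (f := F)).comp (K.measurable_hog π s)

/-- The HOGWILD! step at node `j` against the heat-bath update at the current state. -/
lemma abs_integral_hog_node_sub_le [IsProbabilityMeasure μ]
    (hπ : ∀ x, 0 < π x) (s : ℕ) (j : Fin n) {W : Ω → ℝ}
    (hW : Measurable[K.ℱ s] W) (hW0 : ∀ ω, 0 ≤ W ω) (hW1 : ∀ ω, W ω ≤ 1)
    (h : SpinConfig n → ℝ) :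
    |∫ ω, W ω * h (K.hog π (s + 1) ω) * (if K.node (s + 1) ω = j then 1 else 0) ∂μ
        - (∫ ω, W ω * heatBath (plusProb π) j h (K.hog π s ω) ∂μ) / n| ≤
      τ / n * ∑ k, influence π k j *
        ∫ ω, W ω * K.kappa s k ω * |spinDiff j h (K.hog π s ω)| ∂μ := by
  have hn := K.card_ne_zero
  have hn' : (0 : ℝ) < n := by positivity
  have hD := isDobrushin_plusProb hπ
  have hWabs : ∀ ω, |W ω| ≤ 1 := fun ω => by rw [abs_of_nonneg (hW0 ω)]; exact hW1 ω
  have hWp := hW.mono (K.filtration_le_past s) le_rfl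
  have hy := (K.measurable_hog π s).mono (K.filtration_le_past s) le_rfl
  have hz := K.measurable_staleRead π s
  have hstep := K.integral_greedy_step hπ s j hWp hWabs hy hz h
  simp_rw [hog_succ]
  rw [hstep, ← sub_div, abs_div, Nat.abs_cast, div_mul_eq_mul_div]
  refine div_le_div_of_nonneg_right ?_ hn'.le
  have hbdd : ∀ F : SpinConfig n × SpinConfig n → ℝ,
      Integrable (fun ω => W ω * F (K.hog π s ω, K.staleRead π s ω)) μ := by
    intro F
    obtain ⟨C, hC⟩ := exists_abs_le F
    have hm := (hy.mono (K.past_le s) le_rfl).prodMk (hz.mono (K.past_le s) le_rfl)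
    refine integrable_of_abs_le (C := C) ((hW.mono (K.ℱ.le s) le_rfl).mul
      ((Measurable.of_discrete (f := F)).comp hm)) fun ω => ?_
    rw [abs_mul]
    calc _ ≤ 1 * C := mul_le_mul (hWabs ω) (hC _) (abs_nonneg _) zero_le_one
      _ = C := one_mul C
  have hi1 := hbdd
    (fun a => h (update a.1 j (-1)) + plusProb π j a.2 * spinDiff j h a.1)
  have hi2 := hbdd (fun a => heatBath (plusProb π) j h a.1)
  rw [← integral_sub hi1 hi2]
  obtain ⟨C2, hC2⟩ := exists_abs_le (spinDiff j h)
  have hV : ∀ k, Measurable[K.ℱ s] fun ω => W ω * K.kappa s k ω * |spinDiff j h (K.hog π s ω)| :=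
    fun k => (hW.mul (K.measurable_kappa s k)).mul
      (K.measurable_comp_hog fun x => |spinDiff j h x|)
  have hV0 : ∀ k ω, 0 ≤ W ω * K.kappa s k ω * |spinDiff j h (K.hog π s ω)| := fun k ω =>
    mul_nonneg (mul_nonneg (hW0 ω) (K.kappa_nonneg s k ω)) (abs_nonneg _)
  have hVC : ∀ k ω, W ω * K.kappa s k ω * |spinDiff j h (K.hog π s ω)| ≤
      1 * (1 / n + n) * C2 := fun k ω =>
    mul_le_mul (mul_le_mul (hW1 ω) (K.kappa_le s k ω) (K.kappa_nonneg s k ω) zero_le_one)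
      (hC2 _) (abs_nonneg _) (by positivity)
  -- Everything but the delay is known at time `s`, so the delay may be replaced by the bound `τ` on
  -- its conditional mean.
  have hdel := fun k => K.integral_mul_delay_le s k (hV k) (hV0 k) (hVC k)
  calc |∫ ω, (W ω * (h (update (K.hog π s ω) j (-1)) + plusProb π j (K.staleRead π s ω) *
          spinDiff j h (K.hog π s ω)) - W ω * heatBath (plusProb π) j h (K.hog π s ω)) ∂μ|
      ≤ ∫ ω, |W ω * (h (update (K.hog π s ω) j (-1)) + plusProb π j (K.staleRead π s ω) *
          spinDiff j h (K.hog π s ω)) - W ω * heatBath (plusProb π) j h (K.hog π s ω)| ∂μ :=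
        abs_integral_le_integral_abs
    _ ≤ ∫ ω, ∑ k, influence π k j * (W ω * K.kappa s k ω * |spinDiff j h (K.hog π s ω)| *
          K.delay (s + 1) k ω) ∂μ := by
        refine integral_mono (hi1.sub hi2).abs
          (integrable_finsetSum _ fun k _ => (hdel k).1.const_mul _) fun ω => ?_
        have e : W ω * (h (update (K.hog π s ω) j (-1)) + plusProb π j (K.staleRead π s ω) *
            spinDiff j h (K.hog π s ω)) - W ω * heatBath (plusProb π) j h (K.hog π s ω) =
            W ω * spinDiff j h (K.hog π s ω) *
              (plusProb π j (K.staleRead π s ω) - plusProb π j (K.hog π s ω)) := by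
          simp only [heatBath, spinDiff]; ring
        simp only
        rw [e, abs_mul, abs_mul, abs_of_nonneg (hW0 ω)]
        have hq := abs_sub_le_sum (plusProb π j) (fun k y => hD.abs_spinDiff_le k j y)
          (K.hog π s ω) (K.staleRead π s ω)
        have hnn : 0 ≤ W ω * |spinDiff j h (K.hog π s ω)| := mul_nonneg (hW0 ω) (abs_nonneg _)
        refine (mul_le_mul_of_nonneg_left hq hnn).trans ?_
        rw [Finset.mul_sum]
        refine Finset.sum_le_sum fun k _ => ?_
        have hI := hD.infl_nonneg k j
        have hκ := K.kappa_nonneg s k ω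
        split_ifs with heq
        · rw [mul_zero]
          exact mul_nonneg hI (mul_nonneg (hV0 k ω) (Nat.cast_nonneg _))
        · have h1 := K.one_le_delay_mul_kappa hn s k ω heq
          calc _ = W ω * |spinDiff j h (K.hog π s ω)| * influence π k j * 1 := by ring
            _ ≤ W ω * |spinDiff j h (K.hog π s ω)| * influence π k j *
                (K.delay (s + 1) k ω * K.kappa s k ω) := by gcongr
            _ = _ := by ring
    _ = ∑ k, influence π k j * ∫ ω, W ω * K.kappa s k ω * |spinDiff j h (K.hog π s ω)| *
          K.delay (s + 1) k ω ∂μ := by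
        rw [integral_finsetSum _ fun k _ => (hdel k).1.const_mul _]
        exact Finset.sum_congr rfl fun k _ => integral_const_mul _ _
    _ ≤ τ * ∑ k, influence π k j *
          ∫ ω, W ω * K.kappa s k ω * |spinDiff j h (K.hog π s ω)| ∂μ := by
        rw [Finset.mul_sum]
        refine Finset.sum_le_sum fun k _ => ?_
        calc _ ≤ influence π k j *
              (τ * ∫ ω, W ω * K.kappa s k ω * |spinDiff j h (K.hog π s ω)| ∂μ) :=
              mul_le_mul_of_nonneg_left (hdel k).2 (hD.infl_nonneg k j)
          _ = _ := by ring

lemma sum_node_eq (s : ℕ) (ω : Ω) (c : ℝ) :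
    ∑ j, c * (if K.node (s + 1) ω = j then 1 else 0) = c := by
  simp

lemma integrable_mul_comp [IsProbabilityMeasure μ]
    {W : Ω → ℝ} (hW : Measurable W) (hW0 : ∀ ω, 0 ≤ W ω)
    (hW1 : ∀ ω, W ω ≤ 1) {y : Ω → SpinConfig n} (hy : Measurable y) (F : SpinConfig n → ℝ) :
    Integrable (fun ω => W ω * F (y ω)) μ := by
  obtain ⟨C, hC⟩ := exists_abs_le F
  refine integrable_of_abs_le (C := C) (hW.mul ((Measurable.of_discrete (f := F)).comp hy))
    fun ω => ?_
  rw [abs_mul, abs_of_nonneg (hW0 ω)]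
  calc _ ≤ 1 * C := mul_le_mul (hW1 ω) (hC _) (abs_nonneg _) zero_le_one
    _ = C := one_mul C

lemma integrable_mul_node {f : Ω → ℝ} (hf : Integrable f μ) (s : ℕ) (j : Fin n) :
    Integrable (fun ω => f ω * (if K.node (s + 1) ω = j then 1 else 0)) μ := by
  have hnode : Measurable (K.node (s + 1)) := (K.node_meas s).mono (K.ℱ.le _) le_rfl
  refine hf.mul_bdd (c := 1) (Measurable.ite (hnode (measurableSet_singleton j))
    measurable_const measurable_const).aestronglyMeasurable
    (Filter.Eventually.of_forall fun ω => ?_)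
  split_ifs <;> simp

lemma integral_mul_glauber [IsProbabilityMeasure μ]
    {W : Ω → ℝ} (hW : Measurable W) (hW0 : ∀ ω, 0 ≤ W ω)
    (hW1 : ∀ ω, W ω ≤ 1) {y : Ω → SpinConfig n} (hy : Measurable y) (h : SpinConfig n → ℝ) :
    ∫ ω, W ω * glauber (plusProb π) h (y ω) ∂μ =
      ∑ j, (∫ ω, W ω * heatBath (plusProb π) j h (y ω) ∂μ) / n := by
  rw [← Finset.sum_div, ← integral_finsetSum _ fun j _ => integrable_mul_comp hW hW0 hW1 hy _,
    ← integral_div]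
  congr 1
  funext ω
  rw [glauber, ← Finset.mul_sum, mul_div_assoc]

/-- One HOGWILD! step against one step of the Gibbs sampler. -/
lemma abs_integral_hog_succ_sub_le [IsProbabilityMeasure μ] (hπ : ∀ x, 0 < π x) (s : ℕ) {W : Ω → ℝ}
    (hW : Measurable[K.ℱ s] W) (hW0 : ∀ ω, 0 ≤ W ω) (hW1 : ∀ ω, W ω ≤ 1)
    (h : SpinConfig n → ℝ) :
    |∫ ω, W ω * h (K.hog π (s + 1) ω) ∂μ
        - ∫ ω, W ω * glauber (plusProb π) h (K.hog π s ω) ∂μ| ≤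
      τ / n * ∑ j, ∑ k, influence π k j *
        ∫ ω, W ω * K.kappa s k ω * |spinDiff j h (K.hog π s ω)| ∂μ := by
  have hWm := hW.mono (K.ℱ.le s) le_rfl
  have hym : ∀ s, Measurable (K.hog π s) := fun s => (K.measurable_hog π s).mono (K.ℱ.le s) le_rfl
  have hint := integrable_mul_comp (μ := μ) hWm hW0 hW1 (hym (s + 1)) h
  have h1 : ∫ ω, W ω * h (K.hog π (s + 1) ω) ∂μ = ∑ j, ∫ ω, W ω * h (K.hog π (s + 1) ω) *
      (if K.node (s + 1) ω = j then 1 else 0) ∂μ := by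
    rw [← integral_finsetSum _ fun j _ => K.integrable_mul_node hint s j]
    simp_rw [K.sum_node_eq]
  rw [h1, integral_mul_glauber hWm hW0 hW1 (hym s), ← Finset.sum_sub_distrib, Finset.mul_sum]
  exact (Finset.abs_sum_le_sum_abs _ _).trans
    (Finset.sum_le_sum fun j _ => K.abs_integral_hog_node_sub_le hπ s j hW hW0 hW1 h)

/-- The HOGWILD! chain against the Gibbs sampler started at time `a`. -/
lemma abs_integral_hog_sub_iterate_le [IsProbabilityMeasure μ]
    (hπ : ∀ x, 0 < π x) (a : ℕ) {W : Ω → ℝ}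
    (hW : Measurable[K.ℱ a] W) (hW0 : ∀ ω, 0 ≤ W ω) (hW1 : ∀ ω, W ω ≤ 1) (m : ℕ)
    (h : SpinConfig n → ℝ) :
    |∫ ω, W ω * h (K.hog π (a + m) ω) ∂μ
        - ∫ ω, W ω * (glauber (plusProb π))^[m] h (K.hog π a ω) ∂μ| ≤
      ∑ v ∈ Finset.range m, τ / n * ∑ j, ∑ k, influence π k j *
        ∫ ω, W ω * K.kappa (a + v) k ω *
          |spinDiff j ((glauber (plusProb π))^[m - 1 - v] h) (K.hog π (a + v) ω)| ∂μ := by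
  induction m generalizing h with
  | zero => simp
  | succ m ih =>
    have h1 := K.abs_integral_hog_succ_sub_le hπ (a + m)
      (hW.mono (K.ℱ.mono (Nat.le_add_right a m)) le_rfl) hW0 hW1 h
    -- The last step is peeled off: there `h` is exchanged for `P h`, and the induction hypothesis
    -- treats `P h` over the first `m` steps.
    have h2 := ih (glauber (plusProb π) h)
    rw [Finset.sum_range_succ]
    refine (abs_sub_le _ (∫ ω, W ω * glauber (plusProb π) h (K.hog π (a + m) ω) ∂μ) _).trans ?_
    rw [add_comm]
    refine add_le_add ?_ ?_
    · rw [Function.iterate_succ_apply]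
      refine h2.trans (le_of_eq ?_)
      refine Finset.sum_congr rfl fun v hv => ?_
      have hv' := Finset.mem_range.1 hv
      rw [show m + 1 - 1 - v = m - 1 - v + 1 by omega, Function.iterate_succ_apply]
    · simp only [Nat.add_sub_cancel, Nat.sub_self, Function.iterate_zero, id]
      exact h1

/-- The sequential chain follows the Gibbs sampler. -/
lemma integral_seq [IsProbabilityMeasure μ] (hπ : ∀ x, 0 < π x) (m : ℕ) (h : SpinConfig n → ℝ) :
    ∫ ω, h (K.seq π m ω) ∂μ = ∫ ω, (glauber (plusProb π))^[m] h (K.init ω) ∂μ := by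
  induction m generalizing h with
  | zero => rfl
  | succ m ih =>
    rw [Function.iterate_succ_apply, ← ih]
    have hym : ∀ s, Measurable (K.seq π s) :=
      fun s => (K.measurable_seq π s).mono (K.ℱ.le s) le_rfl
    have hint := integrable_mul_comp (μ := μ) (measurable_const (a := (1 : ℝ)))
      (fun _ => zero_le_one) (fun _ => le_rfl) (hym (m + 1)) h
    have h1 : ∫ ω, h (K.seq π (m + 1) ω) ∂μ = ∑ j, ∫ ω, 1 * h (K.seq π (m + 1) ω) *
        (if K.node (m + 1) ω = j then 1 else 0) ∂μ := by
      rw [← integral_finsetSum _ fun j _ => K.integrable_mul_node hint m j]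
      simp_rw [K.sum_node_eq, one_mul]
    have h2 := integral_mul_glauber (μ := μ) (π := π) (measurable_const (a := (1 : ℝ)))
      (fun _ => zero_le_one) (fun _ => le_rfl) (hym m) h
    simp only [one_mul] at h2
    rw [h1, h2]
    refine Finset.sum_congr rfl fun j _ => ?_
    have hsm := (K.measurable_seq π m).mono (K.filtration_le_past m) le_rfl
    have hstep := K.integral_greedy_step hπ m j (W := fun _ => 1) measurable_const
      (C := 1) (fun _ => by simp) hsm hsm h
    simp_rw [seq_succ]
    rw [hstep]
    congr 2
    funext ω
    simp only [heatBath, spinDiff]; ring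

end GreedyCoupling

/-! ### Moments of the staleness weight, and transfer from the HOGWILD! law to `π`. -/

namespace GreedyCoupling

variable {n : ℕ} {τ : ℝ} {Ω : Type*} [mΩ : MeasurableSpace Ω] {μ : Measure Ω}
  (K : GreedyCoupling n τ μ) {π : SpinConfig n → ℝ}

lemma integrable_comp_hog [IsProbabilityMeasure μ] (s : ℕ) (h : SpinConfig n → ℝ) :
    Integrable (fun ω => h (K.hog π s ω)) μ := by
  have := integrable_mul_comp (μ := μ) (measurable_const (a := (1 : ℝ)))
    (fun _ => zero_le_one) (fun _ => le_rfl)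
    ((K.measurable_hog π s).mono (K.ℱ.le s) le_rfl) h
  simpa using this

lemma measurable_node_ite (s : ℕ) (j : Fin n) :
    Measurable[K.ℱ (s + 1)] fun ω => if K.node (s + 1) ω = j then (1 : ℝ) else 0 :=
  Measurable.ite ((K.node_meas s) (measurableSet_singleton j)) measurable_const measurable_const

lemma integral_node [IsProbabilityMeasure μ] (s : ℕ) (j : Fin n) :
    ∫ ω, (if K.node (s + 1) ω = j then (1 : ℝ) else 0) ∂μ = 1 / n := by
  have := K.integral_mul_node_eq s (A := fun _ => 1) measurable_const j
  simpa using this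

lemma integral_node_mul_node_of_lt [IsProbabilityMeasure μ] {b c : ℕ} (hbc : b < c) (j k : Fin n) :
    ∫ ω, (if K.node (b + 1) ω = j then (1 : ℝ) else 0) *
      (if K.node (c + 1) ω = k then 1 else 0) ∂μ = 1 / n / n := by
  rw [K.integral_mul_node_eq c (((K.measurable_node_ite b j).mono
    ((K.ℱ.mono (by omega)).trans (K.filtration_le_past c)) le_rfl)), K.integral_node]

lemma integral_node_mul_node [IsProbabilityMeasure μ] {b c : ℕ} (hbc : b ≠ c) (j k : Fin n) :
    ∫ ω, (if K.node (b + 1) ω = j then (1 : ℝ) else 0) *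
      (if K.node (c + 1) ω = k then 1 else 0) ∂μ = 1 / n / n := by
  rcases hbc.lt_or_gt with h | h
  · exact K.integral_node_mul_node_of_lt h j k
  · exact (integral_congr_ae (.of_forall fun ω => mul_comm _ _)).trans
      (K.integral_node_mul_node_of_lt h k j)

lemma integral_mul_kappa (s : ℕ) (k : Fin n) {V : Ω → ℝ} (hV : Integrable V μ) :
    ∫ ω, V ω * K.kappa s k ω ∂μ = (∫ ω, V ω ∂μ) / n +
      ∑ l ∈ Finset.range (min n s), 1 / ((l : ℝ) + 1) *
        ∫ ω, V ω * (if K.node (s - l - 1 + 1) ω = k then 1 else 0) ∂μ := by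
  -- The index `s - l` is written as the successor `s - l - 1 + 1`, since the law of the nodes is
  -- given at positive times.
  have e : ∀ ω, V ω * K.kappa s k ω = V ω * (1 / n) +
      ∑ l ∈ Finset.range (min n s), 1 / ((l : ℝ) + 1) *
        (V ω * (if K.node (s - l - 1 + 1) ω = k then 1 else 0)) := by
    intro ω
    rw [kappa, mul_add, Finset.mul_sum]
    congr 1
    refine Finset.sum_congr rfl fun l hl => ?_
    have hl' := Finset.mem_range.1 hl
    rw [show s - l - 1 + 1 = s - l by omega]
    split_ifs <;> ring
  simp_rw [e]
  rw [integral_add (hV.mul_const _)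
    (integrable_finsetSum _ fun l _ => (K.integrable_mul_node hV _ k).const_mul _),
    integral_finsetSum _ fun l _ => (K.integrable_mul_node hV _ k).const_mul _,
    integral_mul_const, mul_one_div]
  congr 1
  exact Finset.sum_congr rfl fun l _ => integral_const_mul _ _

lemma sum_min_le_logBound (s : ℕ) :
    1 + ∑ l ∈ Finset.range (min n s), 1 / ((l : ℝ) + 1) ≤ logBound n := by
  unfold logBound
  gcongr
  exact min_le_left n s

lemma sum_le_logBound {m : ℕ} (hm : m ≤ n) :
    ∑ l ∈ Finset.range m, 1 / ((l : ℝ) + 1) ≤ logBound n := by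
  have := sum_min_le_logBound (n := n) m
  rw [min_eq_right hm] at this
  linarith

lemma logBound_nonneg : 0 ≤ logBound n := by
  unfold logBound; positivity

lemma integral_kappa_le [IsProbabilityMeasure μ]
    (s : ℕ) (k : Fin n) : ∫ ω, K.kappa s k ω ∂μ ≤ logBound n / n := by
  have h := K.integral_mul_kappa s k (V := fun _ => (1 : ℝ)) (integrable_const 1)
  simp only [one_mul] at h
  rw [h]
  simp_rw [K.integral_node]
  rw [← Finset.sum_mul]
  simp only [integral_const, probReal_univ, smul_eq_mul, one_mul, mul_one_div, ← add_div]
  gcongr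
  exact sum_min_le_logBound s

lemma integral_node_mul_kappa_le [IsProbabilityMeasure μ] (b v : ℕ) (j k : Fin n) :
    ∫ ω, (if K.node (b + 1) ω = j then (1 : ℝ) else 0) * K.kappa (b + 1 + v) k ω ∂μ ≤
      logBound n / n / n + if j = k then 1 / n / ((v : ℝ) + 1) else 0 := by
  have hi : Integrable (fun ω => if K.node (b + 1) ω = j then (1 : ℝ) else 0) μ :=
    integrable_of_abs_le (C := 1) ((K.measurable_node_ite b j).mono (K.ℱ.le _) le_rfl)
      fun ω => by split_ifs <;> simp
  rw [K.integral_mul_kappa _ k hi, K.integral_node]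
  have key : ∀ l ∈ Finset.range (min n (b + 1 + v)),
      1 / ((l : ℝ) + 1) * ∫ ω, (if K.node (b + 1) ω = j then (1 : ℝ) else 0) *
        (if K.node (b + 1 + v - l - 1 + 1) ω = k then 1 else 0) ∂μ ≤
      1 / ((l : ℝ) + 1) * (1 / n / n) +
        if l = v then (if j = k then 1 / n / ((v : ℝ) + 1) else 0) else 0 := by
    intro l hl
    have hl' := Finset.mem_range.1 hl
    have hp : (0 : ℝ) ≤ 1 / ((l : ℝ) + 1) * (1 / n / n) := by positivity
    -- The summand `l = v` of `kappa` refers to the update `b + 1` itself: it is fully correlated if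
    -- `j = k` and vanishes otherwise. All other updates are independent of it.
    rcases eq_or_ne l v with rfl | hlv
    · rw [show b + 1 + l - l - 1 + 1 = b + 1 by omega, if_pos rfl]
      split_ifs with hjk
      · subst hjk
        have : ∫ ω, (if K.node (b + 1) ω = j then (1 : ℝ) else 0) *
            (if K.node (b + 1) ω = j then 1 else 0) ∂μ = 1 / n := by
          rw [← K.integral_node b j]
          congr 1; funext ω; split_ifs <;> simp
        rw [this]
        have : 1 / ((l : ℝ) + 1) * (1 / n) = 1 / n / ((l : ℝ) + 1) := by ring
        linarith
      · have : ∫ ω, (if K.node (b + 1) ω = j then (1 : ℝ) else 0) *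
            (if K.node (b + 1) ω = k then 1 else 0) ∂μ = 0 := by
          rw [← integral_zero Ω ℝ]
          congr 1; funext ω
          split_ifs with h1 h2
          · exact absurd (h1.symm.trans h2) hjk
          · simp
          · simp
          · simp
        rw [this]; linarith
    · rw [K.integral_node_mul_node (by omega), if_neg hlv, add_zero]
  have h2 := Finset.sum_le_sum key
  rw [Finset.sum_add_distrib, ← Finset.sum_mul, Finset.sum_ite_eq'] at h2
  have h3 : (if v ∈ Finset.range (min n (b + 1 + v)) then
      (if j = k then 1 / n / ((v : ℝ) + 1) else 0) else 0) ≤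
      if j = k then 1 / n / ((v : ℝ) + 1) else 0 := by
    split_ifs <;> first | exact le_rfl | positivity
  have h4 : 1 / (n : ℝ) / n + (∑ l ∈ Finset.range (min n (b + 1 + v)), 1 / ((l : ℝ) + 1)) *
      (1 / n / n) ≤ logBound n / n / n := by
    have := mul_le_mul_of_nonneg_right (sum_min_le_logBound (n := n) (b + 1 + v))
      (show (0 : ℝ) ≤ 1 / n / n by positivity)
    calc _ = (1 + ∑ l ∈ Finset.range (min n (b + 1 + v)), 1 / ((l : ℝ) + 1)) * (1 / n / n) := by
          ring
      _ ≤ _ := this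
      _ = _ := by ring
  linarith

lemma integrable_mul_kappa_mul [IsProbabilityMeasure μ]
    (s : ℕ) (k : Fin n) {W : Ω → ℝ} (hW : Measurable W)
    (hW0 : ∀ ω, 0 ≤ W ω) (hW1 : ∀ ω, W ω ≤ 1) (F : SpinConfig n → ℝ) :
    Integrable (fun ω => W ω * K.kappa s k ω * F (K.hog π s ω)) μ := by
  obtain ⟨C, hC⟩ := exists_abs_le F
  refine integrable_of_abs_le (C := 1 * (1 / n + n) * C) ((hW.mul
    ((K.measurable_kappa s k).mono (K.ℱ.le s) le_rfl)).mul
    ((K.measurable_comp_hog F).mono (K.ℱ.le s) le_rfl)) fun ω => ?_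
  rw [abs_mul, abs_mul, abs_of_nonneg (hW0 ω), abs_of_nonneg (K.kappa_nonneg s k ω)]
  exact mul_le_mul (mul_le_mul (hW1 ω) (K.kappa_le s k ω) (K.kappa_nonneg s k ω) zero_le_one)
      (hC _) (abs_nonneg _) (by positivity)

lemma integral_mul_kappa_mul_spinDiff_le [IsProbabilityMeasure μ]
    (s : ℕ) (k j : Fin n) {W : Ω → ℝ} (hW : Measurable W)
    (hW0 : ∀ ω, 0 ≤ W ω) (hW1 : ∀ ω, W ω ≤ 1) (h : SpinConfig n → ℝ) :
    ∫ ω, W ω * K.kappa s k ω * |spinDiff j h (K.hog π s ω)| ∂μ ≤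
      spinOsc j h * ∫ ω, W ω * K.kappa s k ω ∂μ := by
  rw [← integral_const_mul]
  have hi := K.integrable_mul_kappa_mul (π := π) s k hW hW0 hW1 (fun _ => 1)
  simp only [mul_one] at hi
  refine integral_mono (K.integrable_mul_kappa_mul s k hW hW0 hW1 fun x => |spinDiff j h x|)
    (hi.const_mul _) fun ω => ?_
  simp only
  rw [mul_comm]
  exact mul_le_mul_of_nonneg_right (abs_spinDiff_le_spinOsc _ _ _)
    (mul_nonneg (hW0 ω) (K.kappa_nonneg s k ω))

lemma geom_sum_contractionRate_le {α : ℝ} (hn : n ≠ 0) (hα0 : 0 ≤ α) (hα : α < 1) (m : ℕ) :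
    ∑ v ∈ Finset.range m, contractionRate n α ^ v ≤ n / (1 - α) := by
  have hn' : (0 : ℝ) < n := by positivity
  have h1 := contractionRate_nonneg hn hα0
  have h2 := contractionRate_lt_one hn hα
  have h := mul_neg_geom_sum (contractionRate n α) m
  have h3 : 1 - contractionRate n α = (1 - α) / n := by unfold contractionRate; ring
  rw [h3] at h
  have h4 : 0 ≤ contractionRate n α ^ m := pow_nonneg h1 m
  have hα' : 0 < 1 - α := by linarith
  rw [le_div_iff₀ hα']
  have h5 : (∑ v ∈ Finset.range m, contractionRate n α ^ v) * (1 - α) =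
      n * ((1 - α) / n * ∑ v ∈ Finset.range m, contractionRate n α ^ v) := by
    field_simp
  rw [h5, h]
  nlinarith

/-- The HOGWILD! chain against the Gibbs sampler, in terms of the total oscillation. -/
lemma abs_integral_hog_sub_iterate_le_totalOsc [IsProbabilityMeasure μ]
    (hπ : ∀ x, 0 < π x) (hα : dobrushin π < 1) (a : ℕ)
    {W : Ω → ℝ} (hW : Measurable[K.ℱ a] W) (hW0 : ∀ ω, 0 ≤ W ω) (hW1 : ∀ ω, W ω ≤ 1) (m : ℕ)
    (h : SpinConfig n → ℝ) {B₁ B₂ : ℝ} (hB₁ : 0 ≤ B₁) (hB₂ : 0 ≤ B₂)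
    (hB : ∀ v < m, ∀ j, ∑ k, influence π k j * ∫ ω, W ω * K.kappa (a + v) k ω ∂μ ≤
      B₁ + B₂ / ((v : ℝ) + 1)) :
    |∫ ω, W ω * h (K.hog π (a + m) ω) ∂μ
        - ∫ ω, W ω * (glauber (plusProb π))^[m] h (K.hog π a ω) ∂μ| ≤
      τ / n * totalOsc h * (B₁ * (n / (1 - dobrushin π)) +
        B₂ * ∑ v ∈ Finset.range m, 1 / ((v : ℝ) + 1)) := by
  have hn := K.card_ne_zero
  have hn' : (0 : ℝ) < n := by positivity
  have hτ := K.tau_nonneg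
  have hD := isDobrushin_plusProb hπ
  have hα0 := hD.alpha_nonneg hn
  have hρ0 := contractionRate_nonneg hn hα0
  have hρ1 := (contractionRate_lt_one hn hα).le
  have hWm := hW.mono (K.ℱ.le a) le_rfl
  set ρ := contractionRate n (dobrushin π) with hρ
  have hS := totalOsc_nonneg h
  refine (K.abs_integral_hog_sub_iterate_le hπ a hW hW0 hW1 m h).trans ?_
  calc _ ≤ ∑ v ∈ Finset.range m,
        τ / n * totalOsc h * (B₁ * ρ ^ (m - 1 - v) + B₂ * (1 / ((v : ℝ) + 1))) := by
        refine Finset.sum_le_sum fun v hv => ?_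
        rw [mul_assoc (τ / (n : ℝ))]
        refine mul_le_mul_of_nonneg_left ?_ (by positivity)
        set g := (glauber (plusProb π))^[m - 1 - v] h with hg
        calc _ ≤ ∑ j, spinOsc j g * (B₁ + B₂ / ((v : ℝ) + 1)) := by
              refine Finset.sum_le_sum fun j _ => ?_
              calc _ ≤ ∑ k, influence π k j *
                    (spinOsc j g * ∫ ω, W ω * K.kappa (a + v) k ω ∂μ) := by
                    refine Finset.sum_le_sum fun k _ => mul_le_mul_of_nonneg_left ?_
                      (hD.infl_nonneg k j)
                    exact K.integral_mul_kappa_mul_spinDiff_le _ k j hWm hW0 hW1 g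
                _ = spinOsc j g *
                    ∑ k, influence π k j * ∫ ω, W ω * K.kappa (a + v) k ω ∂μ := by
                    rw [Finset.mul_sum]
                    exact Finset.sum_congr rfl fun k _ => by ring
                _ ≤ _ := mul_le_mul_of_nonneg_left (hB v (Finset.mem_range.1 hv) j)
                    (spinOsc_nonneg j g)
          _ = totalOsc g * (B₁ + B₂ / ((v : ℝ) + 1)) := by rw [← Finset.sum_mul]; rfl
          _ ≤ ρ ^ (m - 1 - v) * totalOsc h * (B₁ + B₂ / ((v : ℝ) + 1)) := by
              gcongr
              exact hD.totalOsc_iterate_le hn h _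
          _ = totalOsc h * (B₁ * ρ ^ (m - 1 - v) +
                ρ ^ (m - 1 - v) * (B₂ / ((v : ℝ) + 1))) := by ring
          -- The geometric decay is used only for `B₁`; the `B₂` part is left as a harmonic sum.
          _ ≤ totalOsc h * (B₁ * ρ ^ (m - 1 - v) + 1 * (B₂ / ((v : ℝ) + 1))) := by
              gcongr
              exact pow_le_one₀ hρ0 hρ1
          _ = _ := by ring
    _ = τ / n * totalOsc h * (B₁ * ∑ v ∈ Finset.range m, ρ ^ v +
        B₂ * ∑ v ∈ Finset.range m, 1 / ((v : ℝ) + 1)) := by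
        rw [← Finset.mul_sum, Finset.sum_add_distrib, ← Finset.mul_sum, ← Finset.mul_sum,
          Finset.sum_range_reflect (fun v => ρ ^ v) m]
    _ ≤ _ := by
        gcongr
        exact geom_sum_contractionRate_le hn hα0 hα m

/-- `P ^ m h` has the same `π`-mean as `h`, and deviates from it by at most its total oscillation.
-/
lemma iterate_le_wmean_add (hπ : ∀ x, 0 < π x) (hsum : ∑ x, π x = 1) (hn : n ≠ 0)
    (h : SpinConfig n → ℝ) (m : ℕ) (x : SpinConfig n) :
    (glauber (plusProb π))^[m] h x ≤
      wmean π h + contractionRate n (dobrushin π) ^ m * totalOsc h := by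
  have hD := isDobrushin_plusProb hπ
  have hw := isReversible_plusProb hπ hsum
  rw [← hw.wmean_iterate hD.update_self hn h m]
  refine le_trans ?_ (add_le_add_right (hD.totalOsc_iterate_le hn h m) _)
  rw [← sub_le_iff_le_add, ← hw.wmean_const ((glauber (plusProb π))^[m] h x - _)]
  refine hw.wmean_mono fun y => ?_
  have := (le_abs_self _).trans (abs_sub_le_totalOsc ((glauber (plusProb π))^[m] h) y x)
  linarith

/-- The mean of `h` at the HOGWILD! chain. -/
lemma integral_hog_le [IsProbabilityMeasure μ]
    (hπ : ∀ x, 0 < π x) (hsum : ∑ x, π x = 1) (hα : dobrushin π < 1) (s : ℕ)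
    (h : SpinConfig n → ℝ) :
    ∫ ω, h (K.hog π s ω) ∂μ ≤ wmean π h + contractionRate n (dobrushin π) ^ s * totalOsc h +
      τ * dobrushin π * logBound n * totalOsc h / (n * (1 - dobrushin π)) := by
  have hn := K.card_ne_zero
  have hn' : (0 : ℝ) < n := by positivity
  have hD := isDobrushin_plusProb hπ
  have hα0 := hD.alpha_nonneg hn
  have hΛ := logBound_nonneg (n := n)
  have hα1 : 0 < 1 - dobrushin π := by linarith
  have hm := K.abs_integral_hog_sub_iterate_le_totalOsc hπ hα 0 (W := fun _ => 1)
    measurable_const (fun _ => zero_le_one) (fun _ => le_rfl) s h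
    (B₁ := dobrushin π * (logBound n / n)) (B₂ := 0) (by positivity) le_rfl (fun v _ j => by
      simp only [one_mul, zero_div, add_zero]
      calc _ ≤ ∑ k, influence π k j * (logBound n / n) := Finset.sum_le_sum fun k _ =>
            mul_le_mul_of_nonneg_left (K.integral_kappa_le _ k) (hD.infl_nonneg k j)
        _ = (∑ k, influence π k j) * (logBound n / n) := by rw [Finset.sum_mul]
        _ ≤ _ := by gcongr; exact hD.sum_infl_le j)
  simp only [one_mul, zero_mul, add_zero, zero_add] at hm
  have h0 : ∫ ω, (glauber (plusProb π))^[s] h (K.hog π 0 ω) ∂μ ≤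
      wmean π h + contractionRate n (dobrushin π) ^ s * totalOsc h := by
    have hi := K.integrable_comp_hog (π := π) 0 ((glauber (plusProb π))^[s] h)
    have h1 := integral_mono (μ := μ) (g := fun _ : Ω =>
      wmean π h + contractionRate n (dobrushin π) ^ s * totalOsc h) hi (integrable_const _)
      (fun ω => iterate_le_wmean_add hπ hsum hn h s (K.hog π 0 ω))
    simpa using h1
  have h2 := (abs_le.1 hm).2
  have h3 : τ / n * totalOsc h * (dobrushin π * (logBound n / n) * (n / (1 - dobrushin π))) =
      τ * dobrushin π * logBound n * totalOsc h / (n * (1 - dobrushin π)) := by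
    field_simp
  linarith

/-- The mean of `h` at the HOGWILD! chain, on the event that node `j` was updated at a given
recent time. -/
lemma integral_node_mul_hog_le [IsProbabilityMeasure μ] (hπ : ∀ x, 0 < π x) (hsum : ∑ x, π x = 1)
    (hα : dobrushin π < 1) (b : ℕ) {m : ℕ} (hm : m ≤ n) (j : Fin n) (h : SpinConfig n → ℝ) :
    ∫ ω, (if K.node (b + 1) ω = j then 1 else 0) * h (K.hog π (b + 1 + m) ω) ∂μ ≤
      (wmean π h + contractionRate n (dobrushin π) ^ b * totalOsc h +
        4 * (τ * dobrushin π * logBound n * totalOsc h / (n * (1 - dobrushin π)))) / n := by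
  have hn := K.card_ne_zero
  have hn' : (0 : ℝ) < n := by positivity
  have hτ := K.tau_nonneg
  have hD := isDobrushin_plusProb hπ
  have hw := isReversible_plusProb hπ hsum
  set α := dobrushin π with hαdef
  have hα0 := hD.alpha_nonneg hn
  have hΛ := logBound_nonneg (n := n)
  have hα1 : 0 < 1 - α := by linarith
  have hS := totalOsc_nonneg h
  set P := glauber (plusProb π) with hP
  set Z := τ * α * logBound n * totalOsc h / (n * (1 - α)) with hZ
  have hρ0 := contractionRate_nonneg hn hα0
  have hρ1 := (contractionRate_lt_one hn hα).le
  have hSm : totalOsc (P^[m] h) ≤ totalOsc h := (hD.totalOsc_iterate_le hn h m).trans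
    (mul_le_of_le_one_left hS (pow_le_one₀ hρ0 hρ1))
  -- Three comparisons add up to `4 * Z / n`: the `m` steps after the update (`2 * Z / n`), the
  -- update at `j` itself (`Z / n`), and the first `b` steps (`Z / n`).
  have h1 := K.abs_integral_hog_sub_iterate_le_totalOsc hπ hα (b + 1)
    (K.measurable_node_ite b j) (fun ω => by split_ifs <;> simp) (fun ω => by split_ifs <;> simp)
    m h (B₁ := α * (logBound n / n / n)) (B₂ := α * (1 / n)) (by positivity) (by positivity)
    (fun v _ i => by
      calc _ ≤ ∑ k, influence π k i * (logBound n / n / n +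
            if j = k then 1 / n / ((v : ℝ) + 1) else 0) := Finset.sum_le_sum fun k _ =>
            mul_le_mul_of_nonneg_left (K.integral_node_mul_kappa_le b v j k) (hD.infl_nonneg k i)
        _ = (∑ k, influence π k i) * (logBound n / n / n) +
            influence π j i * (1 / n / ((v : ℝ) + 1)) := by
            simp only [mul_add, Finset.sum_add_distrib, mul_ite, mul_zero, Finset.sum_ite_eq,
              Finset.mem_univ, if_true, Finset.sum_mul]
        _ ≤ α * (logBound n / n / n) + α * (1 / n / ((v : ℝ) + 1)) := by
            have hi := hD.sum_infl_le i
            have hj : influence π j i ≤ α := (Finset.single_le_sum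
              (f := fun k => influence π k i) (fun k _ => hD.infl_nonneg k i)
              (Finset.mem_univ j)).trans hi
            gcongr
        _ = _ := by ring)
  have h2 := K.abs_integral_hog_node_sub_le hπ b j (W := fun _ => 1) measurable_const
    (fun _ => zero_le_one) (fun _ => le_rfl) (P^[m] h)
  simp only [one_mul] at h2
  have h3 : τ / n * ∑ k, influence π k j *
      ∫ ω, K.kappa b k ω * |spinDiff j (P^[m] h) (K.hog π b ω)| ∂μ ≤ Z / n := by
    calc _ ≤ τ / n * ∑ k, influence π k j * (totalOsc h * (logBound n / n)) := by
          refine mul_le_mul_of_nonneg_left (Finset.sum_le_sum fun k _ =>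
            mul_le_mul_of_nonneg_left ?_ (hD.infl_nonneg k j)) (by positivity)
          have := K.integral_mul_kappa_mul_spinDiff_le (π := π) b k j (W := fun _ => 1)
            measurable_const (fun _ => zero_le_one) (fun _ => le_rfl) (P^[m] h)
          simp only [one_mul] at this
          refine this.trans (mul_le_mul ((spinOsc_le_totalOsc _ _).trans hSm)
            (K.integral_kappa_le b k) (integral_nonneg fun ω => K.kappa_nonneg b k ω) hS)
      _ = τ / n * ((∑ k, influence π k j) * (totalOsc h * (logBound n / n))) := by
          rw [Finset.sum_mul]
      _ ≤ τ / n * (α * (totalOsc h * (logBound n / n))) := by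
          gcongr; exact hD.sum_infl_le j
      _ = (1 - α) * Z / n := by rw [hZ]; field_simp
      _ ≤ Z / n := by
          have hZ0 : 0 ≤ Z := by positivity
          gcongr
          exact mul_le_of_le_one_left hZ0 (by linarith)
  have h4 := K.integral_hog_le hπ hsum hα b (heatBath (plusProb π) j (P^[m] h))
  -- The event at time `b + 1` has turned into a heat-bath step at `j`, which does not change
  -- `π`-means.
  rw [hw.wmean_heatBath hD.update_self, hw.wmean_iterate hD.update_self hn] at h4
  have hSh : totalOsc (heatBath (plusProb π) j (P^[m] h)) ≤ totalOsc h :=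
    (hD.totalOsc_heatBath_le' hα.le j _).trans hSm
  have h5 : (∫ ω, heatBath (plusProb π) j (P^[m] h) (K.hog π b ω) ∂μ) / n ≤
      (wmean π h + contractionRate n α ^ b * totalOsc h + Z) / n := by
    gcongr
    refine h4.trans ?_
    rw [hZ]
    gcongr
  have h6 : τ / n * totalOsc h * (α * (logBound n / n / n) * (n / (1 - α)) +
      α * (1 / n) * ∑ v ∈ Finset.range m, 1 / ((v : ℝ) + 1)) ≤ 2 * Z / n := by
    calc _ ≤ τ / n * totalOsc h * (α * (logBound n / n / n) * (n / (1 - α)) +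
          α * (1 / n) * (logBound n / (1 - α))) := by
          gcongr
          refine (sum_le_logBound hm).trans ?_
          rw [le_div_iff₀ hα1]
          exact mul_le_of_le_one_right hΛ (by linarith)
      _ = _ := by rw [hZ]; field_simp; ring
  have h7 := (abs_le.1 h1).2
  have h8 := (abs_le.1 h2).2
  have h9 : ∫ ω, (if K.node (b + 1) ω = j then 1 else 0) * P^[m] h (K.hog π (b + 1) ω) ∂μ =
      ∫ ω, P^[m] h (K.hog π (b + 1) ω) * (if K.node (b + 1) ω = j then 1 else 0) ∂μ := by
    simp_rw [mul_comm]
  have h10 : (wmean π h + contractionRate n α ^ b * totalOsc h + 4 * Z) / n =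
      (wmean π h + contractionRate n α ^ b * totalOsc h + Z) / n + Z / n + 2 * Z / n := by ring
  linarith

/-- A nonnegative function of the HOGWILD! chain, weighted by the staleness of node `j`. -/
lemma integral_kappa_mul_hog_le [IsProbabilityMeasure μ] (hπ : ∀ x, 0 < π x) (hsum : ∑ x, π x = 1)
    (hα : dobrushin π < 1) (s : ℕ) (j : Fin n) {h : SpinConfig n → ℝ} (h0 : ∀ x, 0 ≤ h x) :
    ∫ ω, K.kappa s j ω * h (K.hog π s ω) ∂μ ≤ logBound n / n *
      (wmean π h + contractionRate n (dobrushin π) ^ (s - n) * totalOsc h +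
        4 * (τ * dobrushin π * logBound n * totalOsc h / (n * (1 - dobrushin π)))) := by
  have hn := K.card_ne_zero
  have hn' : (0 : ℝ) < n := by positivity
  have hτ := K.tau_nonneg
  have hD := isDobrushin_plusProb hπ
  have hw := isReversible_plusProb hπ hsum
  set α := dobrushin π with hαdef
  have hα0 := hD.alpha_nonneg hn
  have hΛ := logBound_nonneg (n := n)
  have hα1 : 0 < 1 - α := by linarith
  have hS := totalOsc_nonneg h
  set Z := τ * α * logBound n * totalOsc h / (n * (1 - α)) with hZ
  have hZ0 : 0 ≤ Z := by positivity
  have hρ0 := contractionRate_nonneg hn hα0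
  have hρ1 := (contractionRate_lt_one hn hα).le
  set R := wmean π h + contractionRate n α ^ (s - n) * totalOsc h + 4 * Z with hR
  have hmean := hw.wmean_nonneg h0
  have hR0 : 0 ≤ R := by positivity
  -- The updates seen by `kappa` have `l < n`, so at least `s - n` steps precede each of them.
  have hpow : ∀ b, s - n ≤ b → contractionRate n α ^ b * totalOsc h ≤
      contractionRate n α ^ (s - n) * totalOsc h := fun b hb =>
    mul_le_mul_of_nonneg_right (pow_le_pow_of_le_one hρ0 hρ1 hb) hS
  have hi := K.integrable_comp_hog (π := π) (μ := μ) s h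
  simp_rw [mul_comm (K.kappa s j _)]
  rw [K.integral_mul_kappa s j hi]
  have h1 : ∫ ω, h (K.hog π s ω) ∂μ ≤ R := by
    have := K.integral_hog_le hπ hsum hα s h
    have := hpow s (Nat.sub_le s n)
    rw [hR]; linarith
  have h2 : ∀ l ∈ Finset.range (min n s),
      1 / ((l : ℝ) + 1) * ∫ ω, h (K.hog π s ω) *
        (if K.node (s - l - 1 + 1) ω = j then 1 else 0) ∂μ ≤ 1 / ((l : ℝ) + 1) * (R / n) := by
    intro l hl
    have hl' := Finset.mem_range.1 hl
    have hb := K.integral_node_mul_hog_le hπ hsum hα (s - l - 1) (m := l) (by omega) j h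
    rw [show s - l - 1 + 1 + l = s by omega, ← hαdef, ← hZ] at hb
    simp_rw [mul_comm (h _)]
    refine mul_le_mul_of_nonneg_left (hb.trans ?_) (by positivity)
    have := hpow (s - l - 1) (by omega)
    refine div_le_div_of_nonneg_right ?_ hn'.le
    rw [hR]
    linarith
  calc _ ≤ R / n + ∑ l ∈ Finset.range (min n s), 1 / ((l : ℝ) + 1) * (R / n) :=
        add_le_add (by gcongr) (Finset.sum_le_sum h2)
    _ = (1 + ∑ l ∈ Finset.range (min n s), 1 / ((l : ℝ) + 1)) * (R / n) := by
        rw [← Finset.sum_mul]; ring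
    _ ≤ logBound n * (R / n) :=
        mul_le_mul_of_nonneg_right (sum_min_le_logBound s) (by positivity)
    _ = _ := by ring

end GreedyCoupling

/-! ### Numerical estimates. -/

section Constants

lemma logBound_le (n : ℕ) : GreedyCoupling.logBound n ≤ 2 + Real.log n := by
  have h := harmonic_le_one_add_log n
  have e : GreedyCoupling.logBound n = 1 + (harmonic n : ℝ) := by
    simp [GreedyCoupling.logBound, harmonic]
  linarith

lemma logBound_le_log {n : ℕ} (hn : 2 ≤ n) : GreedyCoupling.logBound n ≤ 4 * Real.log n := by
  have h2 : (2 : ℝ) ≤ n := by exact_mod_cast hn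
  have := Real.log_le_log (by norm_num) h2
  have := Real.log_two_gt_d9
  linarith [logBound_le n]

lemma logBound_le_sqrt {n : ℕ} (hn : n ≠ 0) : GreedyCoupling.logBound n ≤ 4 * √n := by
  have h1 : (1 : ℝ) ≤ n := by exact_mod_cast Nat.one_le_iff_ne_zero.2 hn
  have h2 : 1 ≤ √(n : ℝ) := Real.one_le_sqrt.2 h1
  have h3 : Real.log n = 2 * Real.log √n := by rw [Real.log_sqrt (by linarith)]; ring
  have h4 := Real.log_le_sub_one_of_pos (show 0 < √(n : ℝ) by linarith)
  linarith [logBound_le n]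

lemma mul_contractionRate_pow_le {n t : ℕ} {α : ℝ} (hn : n ≠ 0) (hα0 : 0 ≤ α) (hα : α < 1)
    (ht : 6 * n / (1 - α) * Real.log (2 * n) ≤ t) :
    t * contractionRate n α ^ (t - 1 - n) ≤ Real.exp 2 / (1 - α) := by
  have h1 : (1 : ℝ) ≤ n := by exact_mod_cast Nat.one_le_iff_ne_zero.2 hn
  have hn' : (0 : ℝ) < n := by linarith
  have hδ : 0 < 1 - α := by linarith
  set x := (1 - α) * t / n with hx
  -- Half of the exponent in `exp (-x)` absorbs `2 * n`, the other half absorbs `x`. The constant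
  -- `6` in the burn-in time leaves room to spare.
  have hxlog : Real.log (2 * n) ≤ x / 2 := by
    have hl : 0 ≤ Real.log (2 * n) := Real.log_nonneg (by linarith)
    have h6 : 6 * Real.log (2 * n) ≤ x := by
      rw [hx, le_div_iff₀ hn']
      calc 6 * Real.log (2 * n) * n = (1 - α) * (6 * n / (1 - α) * Real.log (2 * n)) := by
            field_simp
        _ ≤ _ := by gcongr
    linarith
  have hpow : contractionRate n α ^ (t - 1 - n) ≤ Real.exp (2 - x) := by
    have hle : contractionRate n α ≤ Real.exp (-((1 - α) / n)) := by
      have := Real.add_one_le_exp (-((1 - α) / n))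
      unfold contractionRate; linarith
    refine (pow_le_pow_left₀ (contractionRate_nonneg hn hα0) hle _).trans ?_
    rw [← Real.exp_nat_mul, Real.exp_le_exp]
    have hm : (t : ℝ) ≤ ((t - 1 - n : ℕ) : ℝ) + (1 + n) := by
      have : t ≤ (t - 1 - n) + (1 + n) := by omega
      exact_mod_cast this
    have h3 : (1 - α) / n * (1 + n) ≤ 2 := by
      rw [div_mul_eq_mul_div, div_le_iff₀ hn']; nlinarith
    have h4 : (1 - α) / n * t ≤ (1 - α) / n * (((t - 1 - n : ℕ) : ℝ) + (1 + n)) := by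
      gcongr
    have h5 : x = (1 - α) / n * t := by rw [hx]; ring
    rw [h5]
    linarith
  have hx2 : x ≤ 2 * Real.exp (x / 2) := by linarith [Real.add_one_le_exp (x / 2)]
  have he : 2 * (n : ℝ) ≤ Real.exp (x / 2) := by
    rw [← Real.exp_log (show (0 : ℝ) < 2 * n by linarith)]
    exact Real.exp_le_exp.2 hxlog
  have ht' : (t : ℝ) = n / (1 - α) * x := by rw [hx]; field_simp
  have hx0 : 0 ≤ x := by rw [hx]; positivity
  calc (t : ℝ) * contractionRate n α ^ (t - 1 - n) ≤ n / (1 - α) * x * Real.exp (2 - x) := by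
        rw [ht']; gcongr
    _ ≤ n / (1 - α) * (2 * Real.exp (x / 2)) * Real.exp (2 - x) := by gcongr
    _ = Real.exp 2 / (1 - α) * (2 * n * (Real.exp (x / 2) * Real.exp (-x))) := by
        rw [sub_eq_add_neg 2 x, Real.exp_add]; ring
    _ ≤ Real.exp 2 / (1 - α) * (Real.exp (x / 2) * (Real.exp (x / 2) * Real.exp (-x))) := by
        gcongr
    _ = Real.exp 2 / (1 - α) := by
        rw [← Real.exp_add, ← Real.exp_add]; ring_nf; simp

end Constants

/-! ### Summation over time, for a general observable. -/

namespace GreedyCoupling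

variable {n : ℕ} {τ : ℝ} {Ω : Type*} [mΩ : MeasurableSpace Ω] {μ : Measure Ω}
  (K : GreedyCoupling n τ μ) {π : SpinConfig n → ℝ}

/-- The bias of `h`, for chains with a given decay of the derivatives of the iterates of `h`. -/
lemma abs_integral_seq_sub_hog_le [IsProbabilityMeasure μ] (hπ : ∀ x, 0 < π x)
    (hsum : ∑ x, π x = 1) (hα : dobrushin π < 1) (h : SpinConfig n → ℝ) {A B : ℝ} (hB : 0 ≤ B)
    (hA : ∀ r, ∑ j, wmean π (fun x => |spinDiff j ((glauber (plusProb π))^[r] h) x|) ≤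
      contractionRate n (dobrushin π) ^ r * A)
    (hB' : ∀ r, totalOsc₂ ((glauber (plusProb π))^[r] h) ≤
      contractionRate n (dobrushin π) ^ r * B) {t : ℕ}
    (ht : 6 * n / (1 - dobrushin π) * Real.log (2 * n) ≤ t) :
    |∫ ω, (h (K.seq π t ω) - h (K.hog π t ω)) ∂μ| ≤
      τ * dobrushin π * logBound n / n ^ 2 * (A * (n / (1 - dobrushin π)) +
        B * (Real.exp 2 / (1 - dobrushin π) +
          4 * τ * dobrushin π * logBound n / (1 - dobrushin π) ^ 2)) := by
  have hn := K.card_ne_zero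
  have hn' : (0 : ℝ) < n := by positivity
  have hτ := K.tau_nonneg
  have hD := isDobrushin_plusProb hπ
  set α := dobrushin π with hαdef
  have hα0 := hD.alpha_nonneg hn
  have hΛ := logBound_nonneg (n := n)
  have hα1 : 0 < 1 - α := by linarith
  have hρ0 := contractionRate_nonneg hn hα0
  have hρ1 := (contractionRate_lt_one hn hα).le
  have hA0 : 0 ≤ A := by
    have h1 := hA 0
    rw [pow_zero, one_mul] at h1
    exact (Finset.sum_nonneg fun j _ => Finset.sum_nonneg fun x _ =>
      mul_nonneg (hπ x).le (abs_nonneg _)).trans h1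
  set P := glauber (plusProb π) with hP
  set ρ := contractionRate n α with hρ
  have hseq : Integrable (fun ω => h (K.seq π t ω)) μ := by
    have := integrable_mul_comp (μ := μ) (measurable_const (a := (1 : ℝ)))
      (fun _ => zero_le_one) (fun _ => le_rfl)
      ((K.measurable_seq π t).mono (K.ℱ.le t) le_rfl) h
    simpa using this
  rw [integral_sub hseq (K.integrable_comp_hog t h), K.integral_seq hπ, abs_sub_comm]
  have hmain := K.abs_integral_hog_sub_iterate_le hπ 0 (W := fun _ => 1)
    measurable_const (fun _ => zero_le_one) (fun _ => le_rfl) t h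
  simp only [one_mul, zero_add, hog_zero] at hmain
  refine hmain.trans ?_
  set Z := 4 * (τ * α * logBound n / (n * (1 - α))) with hZ
  have hZ0 : 0 ≤ Z := by positivity
  have hterm : ∀ s ∈ Finset.range t, τ / n * ∑ j, ∑ k, influence π k j *
      ∫ ω, K.kappa s k ω * |spinDiff j (P^[t - 1 - s] h) (K.hog π s ω)| ∂μ ≤
      τ * α * logBound n / n ^ 2 * (ρ ^ (t - 1 - s) * A + (ρ ^ (t - 1 - n) +
        ρ ^ (t - 1 - s) * Z) * B) := by
    intro s hs
    have hs' := Finset.mem_range.1 hs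
    set g := P^[t - 1 - s] h with hg
    set R : Fin n → ℝ := fun j => wmean π (fun x => |spinDiff j g x|) +
      (ρ ^ (s - n) + Z) * totalOsc (spinDiff j g) with hR
    have hR0 : ∀ j, 0 ≤ R j := fun j => by
      have := totalOsc_nonneg (spinDiff j g)
      have : 0 ≤ wmean π (fun x => |spinDiff j g x|) :=
        Finset.sum_nonneg fun x _ => mul_nonneg (hπ x).le (abs_nonneg _)
      positivity
    have hκ : ∀ j k, ∫ ω, K.kappa s k ω * |spinDiff j g (K.hog π s ω)| ∂μ ≤
        logBound n / n * R j := by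
      intro j k
      refine (K.integral_kappa_mul_hog_le hπ hsum hα s k
        (h := fun x => |spinDiff j g x|) (fun x => abs_nonneg _)).trans ?_
      refine mul_le_mul_of_nonneg_left ?_ (by positivity)
      have hle := totalOsc_abs_le (spinDiff j g)
      calc _ = wmean π (fun x => |spinDiff j g x|) +
            (ρ ^ (s - n) + Z) * totalOsc (fun x => |spinDiff j g x|) := by
            rw [hZ, ← hαdef]; field_simp; ring
        _ ≤ _ := by
            simp only [hR]; gcongr
    have hsumR : ∑ j, R j ≤ ρ ^ (t - 1 - s) * A + (ρ ^ (t - 1 - n) +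
        ρ ^ (t - 1 - s) * Z) * B := by
      calc ∑ j, R j = ∑ j, wmean π (fun x => |spinDiff j g x|) +
            (ρ ^ (s - n) + Z) * totalOsc₂ g := by
            simp only [hR]
            rw [Finset.sum_add_distrib, ← Finset.mul_sum]; rfl
        _ ≤ ρ ^ (t - 1 - s) * A + (ρ ^ (s - n) + Z) * (ρ ^ (t - 1 - s) * B) := by
            gcongr
            · exact hA _
            · exact hB' _
        _ = ρ ^ (t - 1 - s) * A + (ρ ^ (s - n + (t - 1 - s)) + ρ ^ (t - 1 - s) * Z) * B := by
            rw [pow_add]; ring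
        -- The burn-in decay at time `s` and the decay of the iterates combine to a rate that does
        -- not depend on `s`. The sum over `s` then costs a factor `t`, which the lower bound on `t`
        -- compensates.
        _ ≤ _ := by
            have := pow_le_pow_of_le_one hρ0 hρ1
              (show t - 1 - n ≤ s - n + (t - 1 - s) by omega)
            gcongr
    calc _ ≤ τ / n * ∑ j, ∑ k, influence π k j * (logBound n / n * R j) := by
          refine mul_le_mul_of_nonneg_left (Finset.sum_le_sum fun j _ =>
            Finset.sum_le_sum fun k _ => mul_le_mul_of_nonneg_left (hκ j k)
              (hD.infl_nonneg k j)) (by positivity)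
      _ ≤ τ / n * ∑ j, α * (logBound n / n * R j) := by
          refine mul_le_mul_of_nonneg_left (Finset.sum_le_sum fun j _ => ?_) (by positivity)
          rw [← Finset.sum_mul]
          exact mul_le_mul_of_nonneg_right (hD.sum_infl_le j)
            (mul_nonneg (by positivity) (hR0 j))
      _ = τ * α * logBound n / n ^ 2 * ∑ j, R j := by
          rw [← Finset.mul_sum, ← Finset.mul_sum]; field_simp
      _ ≤ _ := mul_le_mul_of_nonneg_left hsumR (by positivity)
  have hgeom : ∑ s ∈ Finset.range t, ρ ^ (t - 1 - s) ≤ n / (1 - α) := by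
    rw [Finset.sum_range_reflect (fun s => ρ ^ s) t]
    exact geom_sum_contractionRate_le hn hα0 hα t
  calc _ ≤ ∑ s ∈ Finset.range t, τ * α * logBound n / n ^ 2 * (ρ ^ (t - 1 - s) * A +
        (ρ ^ (t - 1 - n) + ρ ^ (t - 1 - s) * Z) * B) := Finset.sum_le_sum hterm
    _ = τ * α * logBound n / n ^ 2 * ((∑ s ∈ Finset.range t, ρ ^ (t - 1 - s)) * A +
        (t * ρ ^ (t - 1 - n) + (∑ s ∈ Finset.range t, ρ ^ (t - 1 - s)) * Z) * B) := by
        rw [← Finset.mul_sum, Finset.sum_add_distrib, ← Finset.sum_mul, ← Finset.sum_mul,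
          Finset.sum_add_distrib, ← Finset.sum_mul]
        simp
    _ ≤ τ * α * logBound n / n ^ 2 * (n / (1 - α) * A +
        (Real.exp 2 / (1 - α) + n / (1 - α) * Z) * B) := by
        have := mul_contractionRate_pow_le hn hα0 hα ht
        gcongr
    _ = _ := by rw [hZ]; field_simp

end GreedyCoupling

/-! ### The quadratic form and the final constant. -/

/-- The bias of a quadratic function, with an explicit constant. -/
lemma GreedyCoupling.abs_integral_quadForm_le {n : ℕ} {τ : ℝ} {Ω : Type*} [MeasurableSpace Ω]
    {μ : Measure Ω} [IsProbabilityMeasure μ] (K : GreedyCoupling n τ μ) {p : IsingModel n}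
    (hp : p.NoExternalField) (hn : 2 ≤ n) {δ τ' : ℝ} (hδ : 0 < δ)
    (hα : δ ≤ 1 - dobrushin p.prob) (hτ' : τ ≤ τ')
    (a : {e : Fin n × Fin n // e.1 < e.2} → ℝ) {t : ℕ}
    (ht : 6 * n / (1 - dobrushin p.prob) * Real.log (2 * n) ≤ t) :
    |∫ ω, (quadForm a (K.seq p.prob t ω) - quadForm a (K.hog p.prob t ω)) ∂μ| ≤
      4 * (1 / √((δ / 2) ^ 2 * δ) / δ + (4 + 32 / δ ^ 3) * (Real.exp 2 / δ + 16 * τ' / δ ^ 2)) *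
        (‖a‖ * (τ * dobrushin p.prob * Real.log n) * √n) := by
  have hn0 : n ≠ 0 := by omega
  have hn' : (0 : ℝ) < n := by positivity
  have hπ := p.prob_pos
  have hD := isDobrushin_plusProb hπ
  have hw := isReversible_plusProb hπ p.sum_prob
  have hqneg := plusProb_neg hπ hp.prob_neg
  have hτ := K.tau_nonneg
  have hα0 := hD.alpha_nonneg hn0
  have hlt : dobrushin p.prob < 1 := by linarith
  set α := dobrushin p.prob with hαdef
  -- This is where the absence of an external field bounds the `q (1 - q)` in the Dirichlet form
  -- from below.
  have hq : ∀ i x, δ / 2 ≤ plusProb p.prob i x := fun i x =>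
    le_trans (by linarith) (hD.le_q hqneg i x)
  have hq' : ∀ i x, δ / 2 ≤ 1 - plusProb p.prob i x := fun i x =>
    le_trans (by linarith) (hD.le_one_sub_q hqneg i x)
  have hN : 0 ≤ ‖a‖ := norm_nonneg a
  have hΛ := GreedyCoupling.logBound_nonneg (n := n)
  have hJ : ∀ m, totalOsc₂ (plusProb p.prob m) ≤ 8 / δ ^ 2 := fun m => by
    refine (totalOsc₂_plusProb_le hπ (by linarith : 0 < δ / 2) hq hq'
      p.spinDiff_log_prob_eq_zero m).trans ?_
    have : dobrushin p.prob ^ 2 ≤ 1 := pow_le_one₀ hα0 hlt.le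
    calc 2 * dobrushin p.prob ^ 2 / (δ / 2) ^ 2 ≤ 2 * 1 / (δ / 2) ^ 2 := by gcongr
      _ = _ := by field_simp; norm_num
  have hA : ∀ r, ∑ j, wmean p.prob (fun x => |spinDiff j
      ((glauber (plusProb p.prob))^[r] (quadForm a)) x|) ≤
      contractionRate n α ^ r * (1 / √((δ / 2) ^ 2 * δ) * ‖a‖ * (n * √n)) := by
    intro r
    have hρ0 := contractionRate_nonneg hn0 hα0
    refine (hw.sum_wmean_abs_spinDiff_le hD hn hlt hqneg (c := (δ / 2) ^ 2) (by positivity)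
      (fun i x => ?_) (quadForm_neg a) (by positivity : 0 ≤ 4 * ‖a‖)
      (abs_spinDiff_spinDiff_quadForm_le a) r).trans ?_
    · rw [sq]
      exact mul_le_mul (hq i x) (hq' i x) (by positivity) (hD.nonneg i x)
    · calc contractionRate n α ^ r * (4 * ‖a‖ / (4 * √((δ / 2) ^ 2 * (1 - α)))) * (n * √n)
          ≤ contractionRate n α ^ r * (4 * ‖a‖ / (4 * √((δ / 2) ^ 2 * δ))) * (n * √n) := by
            gcongr
        _ = _ := by field_simp
  have hB : ∀ r, totalOsc₂ ((glauber (plusProb p.prob))^[r] (quadForm a)) ≤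
      contractionRate n α ^ r * ((4 + 32 / δ ^ 3) * ‖a‖ * n ^ 2) := by
    intro r
    have hρ0 := contractionRate_nonneg hn0 hα0
    refine (hD.totalOsc₂_iterate_le hn hlt (by positivity) hJ (quadForm a) r).trans ?_
    refine mul_le_mul_of_nonneg_left ?_ (pow_nonneg hρ0 r)
    have h1 := totalOsc₂_quadForm_le a
    have h2 := totalOsc_quadForm_le a
    calc totalOsc₂ (quadForm a) + 2 * (8 / δ ^ 2) * totalOsc (quadForm a) / (1 - α)
        ≤ n ^ 2 * (4 * ‖a‖) + 2 * (8 / δ ^ 2) * (n ^ 2 * (2 * ‖a‖)) / δ := by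
          have := totalOsc_nonneg (quadForm a)
          gcongr
      _ = _ := by field_simp; ring
  have hbias := K.abs_integral_seq_sub_hog_le hπ p.sum_prob hlt (quadForm a)
    (by positivity) hA hB ht
  refine hbias.trans ?_
  have hs : 1 ≤ √(n : ℝ) := Real.one_le_sqrt.2 (by exact_mod_cast (by omega : 1 ≤ n))
  have hlog : 0 ≤ Real.log n := Real.log_natCast_nonneg n
  -- The factor `logBound n` outside becomes the `log n` of the conclusion. The one inside belongs
  -- to the second-order error and is bounded by `4 * √n`, so that this error has the order of the
  -- main term.
  calc _ ≤ τ * α * GreedyCoupling.logBound n / n ^ 2 *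
        (1 / √((δ / 2) ^ 2 * δ) * ‖a‖ * (n * √n) * (n / δ) +
        (4 + 32 / δ ^ 3) * ‖a‖ * n ^ 2 *
          (Real.exp 2 / δ * √n + 4 * τ' * 1 * (4 * √n) / δ ^ 2)) := by
        have h1 : Real.exp 2 / (1 - α) ≤ Real.exp 2 / δ * √n := by
          calc Real.exp 2 / (1 - α) ≤ Real.exp 2 / δ * 1 := by rw [mul_one]; gcongr
            _ ≤ _ := by gcongr
        have h2 := logBound_le_sqrt hn0
        have hτ'0 : 0 ≤ τ' := hτ.trans hτ'
        gcongr
    _ = (1 / √((δ / 2) ^ 2 * δ) / δ + (4 + 32 / δ ^ 3) * (Real.exp 2 / δ + 16 * τ' / δ ^ 2)) *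
        (‖a‖ * (τ * α * GreedyCoupling.logBound n) * √n) := by
        field_simp; ring
    _ ≤ (1 / √((δ / 2) ^ 2 * δ) / δ + (4 + 32 / δ ^ 3) * (Real.exp 2 / δ + 16 * τ' / δ ^ 2)) *
        (‖a‖ * (τ * α * (4 * Real.log n)) * √n) := by
        have hτ'0 : 0 ≤ τ' := hτ.trans hτ'
        have := logBound_le_log hn
        gcongr
    _ = _ := by ring

theorem mainTheorem4 (τmax αmax : ℝ) (hαmax : αmax < 1) :
    ∃ c : ℝ, 0 < c ∧
      ∀ (n : ℕ) (p : IsingModel n), p.NoExternalField →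
      ∀ α : ℝ, α = dobrushin p.prob → α ≤ αmax →
      ∀ τ : ℝ, τ ≤ τmax →
      ∀ (Ω : Type*) [MeasurableSpace Ω] (μ : Measure Ω) [IsProbabilityMeasure μ]
        (K : GreedyCoupling n τ μ)
        (a : {e : Fin n × Fin n // e.1 < e.2} → ℝ) (t : ℕ),
        6 * n / (1 - α) * Real.log (2 * max ‖a‖ 1 * n) < t →
        |∫ ω, (quadForm a (K.seq p.prob t ω) - quadForm a (K.hog p.prob t ω)) ∂μ| ≤
          c * ‖a‖ * (τ * α * Real.log n / (1 - α) ^ (3 / 2 : ℝ))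
            * (n * Real.log n) ^ (1 / 2 : ℝ) := by
  have hδ : 0 < 1 - αmax := by linarith
  set δ := 1 - αmax with hδdef
  -- `τmax` may be negative, and the constant has to be positive even then.
  set τ' := max τmax 0 with hτ'def
  have hτ'0 : 0 ≤ τ' := le_max_right _ _
  set C := 4 * (1 / √((δ / 2) ^ 2 * δ) / δ +
    (4 + 32 / δ ^ 3) * (Real.exp 2 / δ + 16 * τ' / δ ^ 2)) with hC
  have hC0 : 0 < C := by positivity
  refine ⟨2 * C, by positivity, ?_⟩
  intro n p hp α hα hαle τ hτ Ω _ μ _ K a t ht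
  have hn0 := K.card_ne_zero
  rcases (show n = 1 ∨ 2 ≤ n by omega) with rfl | hn
  -- For `n = 1` there are no pairs and both sides vanish.
  · have hempty : IsEmpty {e : Fin 1 × Fin 1 // e.1 < e.2} :=
      ⟨fun e => absurd e.2 (by rw [Subsingleton.elim e.1.1 e.1.2]; exact lt_irrefl _)⟩
    simp [quadForm]
  have hn' : (2 : ℝ) ≤ n := by exact_mod_cast hn
  have hα0 : 0 ≤ α := hα ▸ (isDobrushin_plusProb p.prob_pos).alpha_nonneg hn0
  have hα1 : 0 < 1 - α := by linarith
  have hτ0 := K.tau_nonneg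
  have ht' : 6 * n / (1 - dobrushin p.prob) * Real.log (2 * n) ≤ t := by
    refine le_trans ?_ ht.le
    rw [← hα]
    have : (2 : ℝ) * n ≤ 2 * max ‖a‖ 1 * n := by nlinarith [le_max_right ‖a‖ 1]
    gcongr
  have hmain := K.abs_integral_quadForm_le hp hn hδ (by rw [← hα]; linarith)
    (hτ.trans (le_max_left _ _ : τmax ≤ τ')) a ht'
  refine hmain.trans ?_
  rw [← hα, ← hC]
  have hlog : 1 / 2 ≤ Real.log n := by
    have := Real.log_le_log (by norm_num) hn'
    have := Real.log_two_gt_d9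
    linarith
  have hsqrt : √(n : ℝ) ≤ 2 * (n * Real.log n) ^ (1 / 2 : ℝ) := by
    rw [← Real.sqrt_eq_rpow]
    refine Real.sqrt_le_iff.2 ⟨by positivity, ?_⟩
    rw [mul_pow, Real.sq_sqrt (by positivity)]
    nlinarith
  -- The true dependence on `1 - α` is already in the constant, through `δ`; the power in the
  -- statement is at most `1` and only weakens the bound.
  have hden : τ * α * Real.log n ≤ τ * α * Real.log n / (1 - α) ^ (3 / 2 : ℝ) := by
    refine le_div_self (by positivity) (Real.rpow_pos_of_pos hα1 _) ?_
    exact Real.rpow_le_one hα1.le (by linarith) (by norm_num)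
  calc C * (‖a‖ * (τ * α * Real.log n) * √n)
      ≤ C * (‖a‖ * (τ * α * Real.log n / (1 - α) ^ (3 / 2 : ℝ)) *
        (2 * (n * Real.log n) ^ (1 / 2 : ℝ))) := by
        gcongr
    _ = _ := by ring
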